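/- **Setting.** For sample size $N$, covariate dimension $p=p_N$ and number of auxiliary tasks $K=K_N$, let $X_i\in\mathbb R^p$ and $\varepsilon_i\in\mathbb R^{K+1}$ ($1\le i\le N$) be random vectors such that the pairs $V_i=(X_i^\top,\varepsilon_i^\top)^\top$ are i.i.d., $E(X_iX_i^\top)=\Sigma_{xx}$, $E(\varepsilon_i)=0$, $\operatorname{cov}(\varepsilon_i)=\Sigma_\varepsilon$, and the noise is uncorrelated with the covariates, $E(X_i\varepsilon_i^\top)=0$ (for instance, independent of them). Let $B=(\beta^{(0)},\dots,\beta^{(K)})\in\mathbb R^{p\times(K+1)}$ and let the responses be $Y_i^{(k)}=X_i^\top\beta^{(k)}+\varepsilon_i^{(k)}$, $0\le k\le K$; task $0$ is the primary one. Write $\lambda_j(A)$ for the $j$-th largest eigenvalue of a symmetric matrix $A$, $\|U\|_{\psi_2}=\inf\{t>0:E\exp(U^2/t^2)\le 2\}$ for a real random variable $U$, and $\|V\|_{\psi_2}=\sup_{\|u\|_2=1}\|u^\top V\|_{\psi_2}$ for a random vector $V$. **Estimators.** Let $\widehat\Sigma_{xx}=N^{-1}\sum_i X_iX_i^\top$,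 let $\widehat B=\widehat\Sigma_{xx}^{-1}N^{-1}\sum_i X_iY_i^\top$ be the matrix of least squares estimators, where $Y_i=(Y_i^{(0)},\dots,Y_i^{(K)})^\top$, and let $\widehat\Sigma_\varepsilon=N^{-1}\sum_i(Y_i-\widehat B^\top X_i)(Y_i-\widehat B^\top X_i)^\top$. For $w\in\mathbb R^{K+1}$ put $\widehat\beta_w=\widehat Bw$. With $d=\operatorname{rank}(B)$: * the ORACLE estimator is $\widehat\beta_{w^*}$, where $w^*$ minimizes $w^\top\Sigma_\varepsilon w$ over all $w$ with $Bw=\beta^{(0)}$; * the FEASIBLE estimator is $\widehat\beta_{\widehat w^*}$, where $\widehat w^*=e_1-\widehat\Theta(\widehat\Theta^\top\widehat\Sigma_\varepsilon\widehat\Theta)^{-1}\widehat\Theta^\top\widehat\Sigma_\varepsilon e_1$, $e_1=(1,0,\dots,0)^\top$, and $\widehat\Theta=(\widehat\nu_{d+1},\dots,\widehat\nu_{K+1})$ with $\widehat\nu_1,\dots,\widehat\nu_{K+1}$ any orthonormal eigenvectors of $\widehat B^\top\widehat B$ in decreasing order of the eigenvalues. **Assumptions.** Let $C_{\rm sub}$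 and $0<\tau_{\min}\le\tau_{\max}$ be fixed constants. * (C1) $\|V_i\|_{\psi_2}\le C_{\rm sub}$. * (C2) All eigenvalues of $\Sigma_{xx}$ and of $\Sigma_\varepsilon$ lie in $[\tau_{\min},\tau_{\max}]$. * (C3) $1\le d<K+1$ and $\tau_{\min}\le\lambda_d(B^\top B)\le\lambda_1(B^\top B)\le\tau_{\max}$. * (C4) $K\to\infty$, $p\to\infty$, $K/p\to0$ and $p/N\to0$ as $N\to\infty$. **Theorem 1.** There are positive constants $C_1$ and $C_2$, depending only on $C_{\rm sub},\tau_{\min},\tau_{\max}$, such that for all sequences $(K_N)$, $(p_N)$ satisfying (C4) there is an $N_0$ such that for every $N>N_0$ and every model of sample size $N$ satisfying (C1)–(C3), with probability at least $1-C_2\exp(-K)$, $$\bigl\|\widehat\beta_{\widehat w^*}-\widehat\beta_{w^*}\bigr\|_2\le C_1\Bigl\{\sqrt{\tfrac{K+d}{N}}+\tfrac pN\Bigr\}.$$ -/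

import Mathlib

open MeasureTheory ProbabilityTheory Filter Topology Matrix
open scoped ENNReal

noncomputable section

namespace AuxLearning

/-! ### Sub-Gaussian norms -/

/-- The sub-Gaussian norm `inf {t > 0 : E exp (U ^ 2 / t ^ 2) ≤ 2}` of a real random variable,
with the value `∞` if there is no such `t`. -/
def psi2Norm {Ω : Type*} [MeasurableSpace Ω] (μ : Measure Ω) (U : Ω → ℝ) : ℝ≥0∞ :=
  ⨅ (t : ℝ) (_ : 0 < t) (_ : ∫⁻ ω, ENNReal.ofReal (Real.exp (U ω ^ 2 / t ^ 2)) ∂μ ≤ 2),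
    ENNReal.ofReal t

/-- The sub-Gaussian norm of a random vector: the supremum of the sub-Gaussian norms of
its one-dimensional projections along Euclidean unit vectors. -/
def psi2NormVec {Ω ι : Type*} [MeasurableSpace Ω] [Fintype ι] (μ : Measure Ω)
    (V : Ω → ι → ℝ) : ℝ≥0∞ :=
  ⨆ (u : ι → ℝ) (_ : u ⬝ᵥ u = 1), psi2Norm μ (fun ω => u ⬝ᵥ V ω)

/-! ### Eigenvalues and eigenvectors of symmetric matrices -/

/-- The `(k + 1)`-st largest eigenvalue (with multiplicity) of a symmetric matrix, for
`k = 0, …, m - 1`. -/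
def eigDesc {m : ℕ} {A : Matrix (Fin m) (Fin m) ℝ} (hA : A.IsHermitian) (k : Fin m) : ℝ :=
  hA.eigenvalues₀ (Fin.cast (Fintype.card_fin m).symm k)

theorem gram_isHermitian {p m : ℕ} (B : Matrix (Fin p) (Fin m) ℝ) : (Bᵀ * B).IsHermitian := by
  simp [Matrix.IsHermitian, Matrix.conjTranspose_eq_transpose_of_trivial]

/-- The columns of `V` are orthonormal eigenvectors of `A`, ordered by decreasing eigenvalue:
`A = ∑ k, lam k • ν k (ν k)ᵀ` with `ν k` the `k`-th column of `V`. -/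
def IsOrderedEigenbasis {m : ℕ} (A V : Matrix (Fin m) (Fin m) ℝ) : Prop :=
  Vᵀ * V = 1 ∧ ∃ lam : Fin m → ℝ, Antitone lam ∧ A = V * Matrix.diagonal lam * Vᵀ

/-- The matrix of all columns of `V` except the first `d`. -/
def dropCols {m : ℕ} (d : ℕ) (V : Matrix (Fin m) (Fin m) ℝ) :
    Matrix (Fin m) {k : Fin m // d ≤ (k : ℕ)} ℝ :=
  V.submatrix id Subtype.val

/-! ### The estimators, as functions of a sample

`x i` is the covariate vector and `y i` the vector of the `K + 1` responses of subject `i`;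
response `0` is the primary one. -/

section Estimators

variable {N p K : ℕ}

/-- `N⁻¹ ∑ i, X i (X i)ᵀ`. -/
def sampleXX (x : Fin N → Fin p → ℝ) : Matrix (Fin p) (Fin p) ℝ :=
  (N : ℝ)⁻¹ • ∑ i, Matrix.vecMulVec (x i) (x i)

/-- The matrix with `k`-th column `N⁻¹ ∑ i, Y i k • X i`. -/
def sampleXY (x : Fin N → Fin p → ℝ) (y : Fin N → Fin (K + 1) → ℝ) :
    Matrix (Fin p) (Fin (K + 1)) ℝ :=
  (N : ℝ)⁻¹ • ∑ i, Matrix.vecMulVec (x i) (y i)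

/-- The matrix whose columns are the least squares estimators of the `K + 1` tasks. -/
def olsMatrix (x : Fin N → Fin p → ℝ) (y : Fin N → Fin (K + 1) → ℝ) :
    Matrix (Fin p) (Fin (K + 1)) ℝ :=
  (sampleXX x)⁻¹ * sampleXY x y

/-- The residual of subject `i` in all tasks. -/
def residual (x : Fin N → Fin p → ℝ) (y : Fin N → Fin (K + 1) → ℝ) (i : Fin N) :
    Fin (K + 1) → ℝ :=
  y i - x i ᵥ* olsMatrix x y

/-- The estimated noise covariance matrix `N⁻¹ ∑ i, r i (r i)ᵀ`, with `r i` the residuals. -/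
def noiseCovHat (x : Fin N → Fin p → ℝ) (y : Fin N → Fin (K + 1) → ℝ) :
    Matrix (Fin (K + 1)) (Fin (K + 1)) ℝ :=
  (N : ℝ)⁻¹ • ∑ i, Matrix.vecMulVec (residual x y i) (residual x y i)

/-- The weighted estimator with weight vector `w`. -/
def weightedEst (x : Fin N → Fin p → ℝ) (y : Fin N → Fin (K + 1) → ℝ) (w : Fin (K + 1) → ℝ) :
    Fin p → ℝ :=
  olsMatrix x y *ᵥ w

/-- `w` is an optimal weight: it minimizes `wᵀ S w` over all `w` with `B w = β⁽⁰⁾`, the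
column `0` of `B`. -/
def IsOptimalWeight (B : Matrix (Fin p) (Fin (K + 1)) ℝ)
    (S : Matrix (Fin (K + 1)) (Fin (K + 1)) ℝ) (w : Fin (K + 1) → ℝ) : Prop :=
  B *ᵥ w = (fun j => B j 0) ∧
    ∀ w' : Fin (K + 1) → ℝ, B *ᵥ w' = (fun j => B j 0) → w ⬝ᵥ S *ᵥ w ≤ w' ⬝ᵥ S *ᵥ w'

/-- `e₁ - T (Tᵀ S T)⁻¹ Tᵀ S e₁`. -/
def plugInWeight {κ : Type*} [Fintype κ] [DecidableEq κ]
    (T : Matrix (Fin (K + 1)) κ ℝ) (S : Matrix (Fin (K + 1)) (Fin (K + 1)) ℝ) :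
    Fin (K + 1) → ℝ :=
  Pi.single 0 1 - (T * (Tᵀ * S * T)⁻¹ * Tᵀ * S) *ᵥ Pi.single 0 1

/-- The feasible weight vector; `V` holds the ordered eigenvectors of the Gram matrix of
`olsMatrix x y`. -/
def feasibleWeight (d : ℕ) (x : Fin N → Fin p → ℝ) (y : Fin N → Fin (K + 1) → ℝ)
    (V : Matrix (Fin (K + 1)) (Fin (K + 1)) ℝ) : Fin (K + 1) → ℝ :=
  plugInWeight (dropCols d V) (noiseCovHat x y)

/-- The responses `Y i k = (X i)ᵀ β⁽ᵏ⁾ + ε i k`. -/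
def response (B : Matrix (Fin p) (Fin (K + 1)) ℝ) (x : Fin N → Fin p → ℝ)
    (e : Fin N → Fin (K + 1) → ℝ) : Fin N → Fin (K + 1) → ℝ :=
  fun i => x i ᵥ* B + e i

end Estimators

/-! ### The model -/

/-- The multi-task linear regression model: the vectors `(X i, ε i)` are independent and
identically distributed, with `E (X Xᵀ) = Sxx`, `E ε = 0`, `cov ε = Se`, and the noise is
uncorrelated with the covariates. -/
structure IsRegressionModel {Ω : Type*} [MeasurableSpace Ω] (μ : Measure Ω) {N p K : ℕ}
    (X : Fin N → Ω → Fin p → ℝ) (e : Fin N → Ω → Fin (K + 1) → ℝ)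
    (Sxx : Matrix (Fin p) (Fin p) ℝ) (Se : Matrix (Fin (K + 1)) (Fin (K + 1)) ℝ) : Prop where
  measurable_X : ∀ i, Measurable (X i)
  measurable_e : ∀ i, Measurable (e i)
  indep : iIndepFun (fun i ω => Sum.elim (X i ω) (e i ω)) μ
  identDistrib : ∀ i j, IdentDistrib (fun ω => Sum.elim (X i ω) (e i ω))
    (fun ω => Sum.elim (X j ω) (e j ω)) μ μ
  secondMoment_X : ∀ i a b, ∫ ω, X i ω a * X i ω b ∂μ = Sxx a b
  mean_e : ∀ i k, ∫ ω, e i ω k ∂μ = 0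
  cov_e : ∀ i k l, cov[fun ω => e i ω k, fun ω => e i ω l; μ] = Se k l
  uncorrelated : ∀ i a k, ∫ ω, X i ω a * e i ω k ∂μ = 0

/-- Sub-Gaussian condition. -/
def SubGaussianCondition {Ω : Type*} [MeasurableSpace Ω] (μ : Measure Ω) {N p K : ℕ}
    (X : Fin N → Ω → Fin p → ℝ) (e : Fin N → Ω → Fin (K + 1) → ℝ) (Csub : ℝ) : Prop :=
  ∀ i, psi2NormVec μ (fun ω => Sum.elim (X i ω) (e i ω)) ≤ ENNReal.ofReal Csub

/-- All eigenvalues of the (symmetric) matrix `S` lie in `[τmin, τmax]`. -/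
def EigenvaluesIn {m : ℕ} (S : Matrix (Fin m) (Fin m) ℝ) (τmin τmax : ℝ) : Prop :=
  spectrum ℝ S ⊆ Set.Icc τmin τmax

/-- `B` has rank `d` with `1 ≤ d < K + 1`, the `d`-th largest eigenvalue of `Bᵀ B` is at least
`τmin` and the largest one is at most `τmax`. -/
structure CoefficientCondition {p K : ℕ} (B : Matrix (Fin p) (Fin (K + 1)) ℝ) (d : ℕ)
    (τmin τmax : ℝ) : Prop where
  pos : 1 ≤ d
  lt : d < K + 1
  rank_eq : B.rank = d
  lower : ∀ k : Fin (K + 1), (k : ℕ) + 1 = d → τmin ≤ eigDesc (gram_isHermitian B) k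
  upper : eigDesc (gram_isHermitian B) 0 ≤ τmax

/-- Divergence rates of the number `K N` of auxiliary tasks and the dimension `p N`. -/
structure DivergenceCondition (K p : ℕ → ℕ) : Prop where
  K_tendsto : Tendsto K atTop atTop
  p_tendsto : Tendsto p atTop atTop
  K_div_p : Tendsto (fun N => (K N : ℝ) / (p N : ℝ)) atTop (𝓝 0)
  p_div_N : Tendsto (fun N => (p N : ℝ) / (N : ℝ)) atTop (𝓝 0)

end AuxLearning

end

/-!
# Feasible versus oracle weights

Let `G = N⁻¹ ∑ Xᵢ εᵢᵀ` and `E = Σ̂⁻¹ G`, so that the least squares matrix is `B̂ = B + E`, with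
`‖E‖` of order `√(p/N)`, and the estimated noise covariance is `N⁻¹ ∑ εᵢ εᵢᵀ - Gᵀ E`. With
`ŵ = e₁ - û` the feasible and `w` the oracle weight, `B w = B e₁` gives
`B̂ (ŵ - w) = E (ŵ - w) - B û`, and the two terms are of the stated order for different reasons.

* `E (ŵ - w)`. The estimated null space, spanned by the last eigenvectors of `B̂ᵀ B̂`, is within
  `O(‖E‖)` of `ker B` (Weyl's inequality, `IsSVD.isNoiseSpace`), and the two first order conditions
  turn this into `‖ŵ - w‖ = O(√(p/N))`. The term is therefore `O(p/N)`.
* `B û`. For `û` in the estimated null space, `B̂ᵀ B̂ û` and `Eᵀ B̂ û` are both `O(‖E‖²)`, hence so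
  is `Bᵀ B̂ û`. As `Bᵀ` is bounded below on the column space of `B`, with orthonormal basis `U`,
  the vector `B û` equals `-U Uᵀ E û` up to `O(p/N)`. Only the `d × (K + 1)` matrix
  `Uᵀ E = Uᵀ Σ⁻¹ G + O(p/N)` enters, and its norm is of order `√((K + d)/N)`, not `√(p/N)`.

This is `l2norm_perturbed_weight_sub_le`, applied to a fixed sample in
`l2norm_weightedEst_sub_le`. The probabilistic input is one inequality,
`crossMoment_concentration`: the sample cross-moment matrix of sub-Gaussian vectors whose dimensions
add up to at most `2 n` is within a multiple of `√(n/N)` of its expectation, up to probability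
`2 exp (-n)`. It is used with `n = p` for the pairs `(X, X)`, `(X, ε)`, `(ε, ε)`, and with
`n = K + d` for `(Uᵀ Σ⁻¹ X, ε)`.
-/

namespace AuxLearning

open scoped Matrix.Norms.L2Operator

/-! ### Concentration of empirical averages -/

theorem sq_le_exp_half_abs (y : ℝ) : y ^ 2 ≤ 8 * Real.exp (|y| / 2) := by
  have h := Real.quadratic_le_exp_of_nonneg (x := |y| / 2) (by positivity)
  nlinarith [sq_abs y, abs_nonneg y]

/-- The pointwise inequality behind the bound on moment generating functions; half of the exponent
`|y|` pays for the remainder of the exponential and half for `y ^ 2`. -/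
theorem exp_mul_le {l : ℝ} (hl : |l| ≤ 1 / 2) (y : ℝ) :
    Real.exp (l * y) ≤ 1 + l * y + 8 * l ^ 2 * Real.exp |y| := by
  have key : ∀ x : ℝ, Real.exp x ≤ 1 + x + x ^ 2 * Real.exp |x| := by
    intro x
    have := Complex.norm_exp_sub_sum_le_norm_mul_exp (x : ℂ) 2
    simp only [Finset.sum_range_succ, Finset.sum_range_zero, Complex.norm_real,
      Real.norm_eq_abs, sq_abs] at this
    norm_num at this
    rw [← Complex.ofReal_exp, ← Complex.ofReal_one, ← Complex.ofReal_add, ← Complex.ofReal_sub,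
      Complex.norm_real, Real.norm_eq_abs] at this
    linarith [le_abs_self (Real.exp x - (1 + x))]
  have h1 : Real.exp |l * y| ≤ Real.exp (|y| / 2) := by
    apply Real.exp_le_exp.2
    rw [abs_mul]; nlinarith [abs_nonneg y]
  have h2 : Real.exp |y| = Real.exp (|y| / 2) * Real.exp (|y| / 2) := by
    rw [← Real.exp_add]; ring_nf
  have h3 := sq_le_exp_half_abs y
  have h4 := key (l * y)
  have h5 : (l * y) ^ 2 * Real.exp |l * y| ≤
      (l ^ 2 * (8 * Real.exp (|y| / 2))) * Real.exp (|y| / 2) := by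
    rw [mul_pow]
    gcongr
  rw [h2]
  nlinarith

section Scalar

variable {Ω : Type*} [MeasurableSpace Ω] {μ : Measure Ω}

theorem integrable_exp_abs {Y : Ω → ℝ} (hY : Measurable Y)
    (h : ∫⁻ ω, ENNReal.ofReal (Real.exp |Y ω|) ∂μ ≤ 2) :
    Integrable (fun ω => Real.exp |Y ω|) μ := by
  refine ⟨by fun_prop, ?_⟩
  rw [hasFiniteIntegral_iff_ofReal (ae_of_all _ fun ω => (Real.exp_pos _).le)]
  exact h.trans_lt (by simp)

theorem integral_exp_abs_le {Y : Ω → ℝ} (hY : Measurable Y)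
    (h : ∫⁻ ω, ENNReal.ofReal (Real.exp |Y ω|) ∂μ ≤ 2) :
    ∫ ω, Real.exp |Y ω| ∂μ ≤ 2 := by
  rw [integral_eq_lintegral_of_nonneg_ae (ae_of_all _ fun ω => (Real.exp_pos _).le) (by fun_prop)]
  exact ENNReal.toReal_le_of_le_ofReal (by norm_num) (by simpa using h)

theorem integrable_of_exp_abs {Y : Ω → ℝ} (hY : Measurable Y)
    (h : ∫⁻ ω, ENNReal.ofReal (Real.exp |Y ω|) ∂μ ≤ 2) : Integrable Y μ := by
  refine (integrable_exp_abs hY h).mono' hY.aestronglyMeasurable (ae_of_all _ fun ω => ?_)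
  have := Real.add_one_le_exp |Y ω|
  rw [Real.norm_eq_abs]; linarith

theorem integrable_exp_mul {Y : Ω → ℝ} (hY : Measurable Y)
    (h : ∫⁻ ω, ENNReal.ofReal (Real.exp |Y ω|) ∂μ ≤ 2) {l : ℝ} (hl : |l| ≤ 1 / 2) :
    Integrable (fun ω => Real.exp (l * Y ω)) μ := by
  refine (integrable_exp_abs hY h).mono' (by fun_prop) (ae_of_all _ fun ω => ?_)
  rw [Real.norm_eq_abs, Real.abs_exp]
  apply Real.exp_le_exp.2
  calc l * Y ω ≤ |l * Y ω| := le_abs_self _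
    _ = |l| * |Y ω| := abs_mul _ _
    _ ≤ |Y ω| := by nlinarith [abs_nonneg (Y ω)]

/-- A variable with `E exp |Y| ≤ 2` has the moment generating function of a Gaussian near `0`. -/
theorem mgf_sub_integral_le [IsProbabilityMeasure μ] {Y : Ω → ℝ} (hY : Measurable Y)
    (h : ∫⁻ ω, ENNReal.ofReal (Real.exp |Y ω|) ∂μ ≤ 2) {l : ℝ} (hl : |l| ≤ 1 / 2) :
    mgf (fun ω => Y ω - ∫ ω', Y ω' ∂μ) μ l ≤ Real.exp (16 * l ^ 2) := by
  have hi := integrable_of_exp_abs hY h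
  have he := integrable_exp_abs hY h
  set m := ∫ ω', Y ω' ∂μ with hm
  have h1 : mgf Y μ l ≤ Real.exp (l * m + 16 * l ^ 2) := by
    calc mgf Y μ l ≤ ∫ ω, (1 + l * Y ω + 8 * l ^ 2 * Real.exp |Y ω|) ∂μ :=
          integral_mono (integrable_exp_mul hY h hl)
            (((integrable_const _).add (hi.const_mul _)).add (he.const_mul _))
            fun ω => exp_mul_le hl (Y ω)
      _ = 1 + l * m + 8 * l ^ 2 * ∫ ω, Real.exp |Y ω| ∂μ := by
          have e1 := integral_add ((integrable_const (μ := μ) (1 : ℝ)).add (hi.const_mul l))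
            (he.const_mul (8 * l ^ 2))
          have e2 := integral_add (integrable_const (μ := μ) (1 : ℝ)) (hi.const_mul l)
          simp only [Pi.add_apply] at e1
          rw [e1, e2, integral_const_mul, integral_const_mul]
          simp [hm]
      _ ≤ l * m + 16 * l ^ 2 + 1 := by nlinarith [integral_exp_abs_le hY h, sq_nonneg l]
      _ ≤ _ := Real.add_one_le_exp _
  have h2 : mgf (fun ω => Y ω - m) μ l = Real.exp (-(l * m)) * mgf Y μ l := by
    simp only [mgf]
    rw [← integral_const_mul]
    congr 1; ext ω
    rw [← Real.exp_add]; ring_nf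
  rw [h2]
  calc _ ≤ Real.exp (-(l * m)) * Real.exp (l * m + 16 * l ^ 2) := by gcongr
    _ = _ := by rw [← Real.exp_add]; ring_nf

/-- One half of Bernstein's inequality: the exponential moments `E exp |Y i| ≤ 2` give a
Gaussian upper tail up to deviations of constant order. -/
theorem measure_sum_ge_le [IsProbabilityMeasure μ] {N : ℕ} {Y : Fin N → Ω → ℝ}
    (hY : ∀ i, Measurable (Y i)) (hind : iIndepFun Y μ)
    (h : ∀ i, ∫⁻ ω, ENNReal.ofReal (Real.exp |Y i ω|) ∂μ ≤ 2) {s : ℝ} (hs : 0 ≤ s)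
    (hs_le : s ≤ 16) :
    μ.real {ω | N * s ≤ ∑ i, (Y i ω - ∫ ω', Y i ω' ∂μ)} ≤
      Real.exp (-(N * s ^ 2 / 64)) := by
  -- `l = s / 32` minimizes the exponent `-l * s + 16 * l ^ 2`
  have hl : |s / 32| ≤ 1 / 2 := by rw [abs_of_nonneg (by positivity)]; linarith
  set Z : Fin N → Ω → ℝ := fun i ω => Y i ω - ∫ ω', Y i ω' ∂μ with hZ
  have hZm : ∀ i, Measurable (Z i) := fun i => (hY i).sub_const _
  have hZind : iIndepFun Z μ :=
    hind.comp (fun i x => x - ∫ ω', Y i ω' ∂μ) fun i => measurable_id.sub_const _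
  have hZint : ∀ i, Integrable (fun ω => Real.exp (s / 32 * Z i ω)) μ := by
    intro i
    have := (integrable_exp_mul (hY i) (h i) hl).mul_const
      (Real.exp (-(s / 32 * ∫ ω', Y i ω' ∂μ)))
    refine this.congr (ae_of_all _ fun ω => ?_)
    simp only [hZ]; rw [← Real.exp_add]; ring_nf
  have hint : Integrable (fun ω => Real.exp (s / 32 * (∑ i, Z i) ω)) μ :=
    hZind.integrable_exp_mul_sum hZm fun i _ => hZint i
  have := measure_ge_le_exp_mul_mgf (μ := μ) (X := ∑ i, Z i) (N * s) (t := s / 32)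
    (by positivity) hint
  rw [hZind.mgf_sum hZm] at this
  simp only [Finset.sum_apply] at this
  refine this.trans ?_
  calc _ ≤ Real.exp (-(s / 32) * (N * s)) * ∏ i : Fin N, Real.exp (16 * (s / 32) ^ 2) := by
        gcongr with i
        · intro i _; exact mgf_nonneg
        · exact mgf_sub_integral_le (hY i) (h i) hl
    _ = _ := by
        rw [Finset.prod_const, ← Real.exp_nat_mul, ← Real.exp_add]
        simp only [Finset.card_univ, Fintype.card_fin]
        ring_nf

/-- Bernstein's inequality for variables with `E exp |Y i| ≤ 2`. -/
theorem measure_abs_sum_ge_le [IsProbabilityMeasure μ] {N : ℕ} {Y : Fin N → Ω → ℝ}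
    (hY : ∀ i, Measurable (Y i)) (hind : iIndepFun Y μ)
    (h : ∀ i, ∫⁻ ω, ENNReal.ofReal (Real.exp |Y i ω|) ∂μ ≤ 2) {s : ℝ} (hs : 0 ≤ s)
    (hs_le : s ≤ 16) :
    μ.real {ω | N * s ≤ |∑ i, (Y i ω - ∫ ω', Y i ω' ∂μ)|} ≤
      2 * Real.exp (-(N * s ^ 2 / 64)) := by
  have h1 := measure_sum_ge_le hY hind h hs hs_le
  have h2 := measure_sum_ge_le (Y := fun i ω => -Y i ω) (fun i => (hY i).neg)
    (hind.comp (fun _ x => -x) fun _ => measurable_neg) (by simpa using h) hs hs_le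
  have hsub : {ω | N * s ≤ |∑ i, (Y i ω - ∫ ω', Y i ω' ∂μ)|} ⊆
      {ω | N * s ≤ ∑ i, (Y i ω - ∫ ω', Y i ω' ∂μ)} ∪
      {ω | N * s ≤ ∑ i, (-Y i ω - ∫ ω', -Y i ω' ∂μ)} := by
    intro ω hω
    rcases le_abs.1 (show N * s ≤ |_| from hω) with h | h
    · exact Or.inl h
    · refine Or.inr ?_
      rw [← Finset.sum_neg_distrib] at h
      refine h.trans_eq (Finset.sum_congr rfl fun i _ => ?_)
      rw [integral_neg]; ring
  calc _ ≤ _ := measureReal_mono hsub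
    _ ≤ _ := measureReal_union_le _ _
    _ ≤ _ := by linarith

end Scalar

/-! ### Operator norms and nets -/

/-- The Euclidean norm of a coordinate vector. -/
noncomputable abbrev l2norm {ι : Type*} [Fintype ι] (v : ι → ℝ) : ℝ := ‖WithLp.toLp 2 v‖

section Norms

variable {ι κ : Type*} [Fintype ι] [Fintype κ]

theorem l2norm_sq (v : ι → ℝ) : l2norm v ^ 2 = v ⬝ᵥ v := by
  rw [l2norm, EuclideanSpace.norm_sq_eq]
  simp [dotProduct, sq]

theorem l2norm_inv_smul {z : ι → ℝ} (hz : l2norm z ≠ 0) : l2norm ((l2norm z)⁻¹ • z) = 1 := by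
  rw [l2norm, WithLp.toLp_smul, norm_smul, norm_inv, norm_norm, inv_mul_cancel₀ hz]

theorem abs_dotProduct_le (u v : ι → ℝ) : |u ⬝ᵥ v| ≤ l2norm u * l2norm v := by
  have := abs_real_inner_le_norm (WithLp.toLp 2 u) (WithLp.toLp 2 v)
  rwa [EuclideanSpace.inner_toLp_toLp, star_trivial, dotProduct_comm] at this

theorem l2norm_mulVec_le [DecidableEq κ] (A : Matrix ι κ ℝ) (v : κ → ℝ) :
    l2norm (A *ᵥ v) ≤ ‖A‖ * l2norm v :=
  l2_opNorm_mulVec A (WithLp.toLp 2 v)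

theorem opNorm_le_of_mulVec [DecidableEq κ] {A : Matrix ι κ ℝ} {C : ℝ} (hC : 0 ≤ C)
    (h : ∀ v, l2norm (A *ᵥ v) ≤ C * l2norm v) : ‖A‖ ≤ C := by
  rw [l2_opNorm_def]
  exact ContinuousLinearMap.opNorm_le_bound _ hC fun v => h v.ofLp

theorem opNorm_transpose [DecidableEq ι] [DecidableEq κ] (A : Matrix ι κ ℝ) : ‖Aᵀ‖ = ‖A‖ := by
  rw [← conjTranspose_eq_transpose_of_trivial, l2_opNorm_conjTranspose]

/-- The Euclidean unit ball of dimension `n` has a `1 / 2`-net with at most `5 ^ n` points. -/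
theorem exists_net (ι : Type*) [Fintype ι] : ∃ T : Finset (ι → ℝ), T.card ≤ 5 ^ Fintype.card ι ∧
    (∀ t ∈ T, l2norm t ≤ 1) ∧ ∀ x, l2norm x ≤ 1 → ∃ t ∈ T, l2norm (x - t) ≤ 1 / 2 := by
  classical
  -- a separated set of maximal cardinality in the unit ball is a net
  let P : ℕ → Prop := fun n => ∃ T : Finset (ι → ℝ), T.card = n ∧ (∀ t ∈ T, l2norm t ≤ 1) ∧
    ∀ s ∈ T, ∀ t ∈ T, s ≠ t → 1 / 2 ≤ l2norm (s - t)
  have hb : ∀ T : Finset (ι → ℝ), (∀ t ∈ T, l2norm t ≤ 1) →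
      (∀ s ∈ T, ∀ t ∈ T, s ≠ t → 1 / 2 ≤ l2norm (s - t)) → T.card ≤ 5 ^ Fintype.card ι := by
    intro T h1 h2
    let f : (ι → ℝ) → EuclideanSpace ℝ ι := fun t => (2 : ℝ) • WithLp.toLp 2 t
    have hf : Function.Injective f := by
      intro s t hst
      have := smul_right_injective (EuclideanSpace ℝ ι) (two_ne_zero' ℝ) hst
      exact WithLp.toLp_injective 2 this
    rw [← Finset.card_image_of_injective T hf, ← finrank_euclideanSpace (𝕜 := ℝ) (ι := ι)]
    apply Besicovitch.card_le_of_separated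
    · intro c hc
      obtain ⟨t, ht, rfl⟩ := Finset.mem_image.1 hc
      have := h1 t ht
      simp only [f, norm_smul, Real.norm_ofNat]; linarith
    · intro c hc d hd hcd
      obtain ⟨s, hs, rfl⟩ := Finset.mem_image.1 hc
      obtain ⟨t, ht, rfl⟩ := Finset.mem_image.1 hd
      have := h2 s hs t ht (fun h => hcd (by rw [h]))
      simp only [f, ← smul_sub, norm_smul, Real.norm_ofNat, ← WithLp.toLp_sub]; linarith
  have h0 : P 0 := ⟨∅, by simp⟩
  obtain ⟨T, hT, h1, h2⟩ := Nat.findGreatest_spec (P := P) (n := 5 ^ Fintype.card ι)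
    (Nat.zero_le _) h0
  refine ⟨T, hb T h1 h2, h1, fun x hx => ?_⟩
  by_contra! hcon
  have hxT : x ∉ T := fun h => by
    have := hcon x h
    rw [sub_self, l2norm, WithLp.toLp_zero, norm_zero] at this
    norm_num at this
  have h1' : ∀ t ∈ insert x T, l2norm t ≤ 1 := by
    intro t ht
    rcases Finset.mem_insert.1 ht with rfl | ht
    exacts [hx, h1 t ht]
  have h2' : ∀ s ∈ insert x T, ∀ t ∈ insert x T, s ≠ t → 1 / 2 ≤ l2norm (s - t) := by
    intro s hs t ht hst
    rcases Finset.mem_insert.1 hs with hs | hs <;> rcases Finset.mem_insert.1 ht with ht | ht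
    · exact absurd (hs.trans ht.symm) hst
    · rw [hs]; exact (hcon t ht).le
    · rw [ht, l2norm, WithLp.toLp_sub, norm_sub_rev, ← WithLp.toLp_sub]; exact (hcon s hs).le
    · exact h2 s hs t ht hst
  have hc := hb _ h1' h2'
  have := Nat.le_findGreatest hc (show P _ from ⟨_, rfl, h1', h2'⟩)
  rw [Finset.card_insert_of_notMem hxT, hT] at this
  omega

/-- A matrix is bounded by `4 r` if its bilinear form is bounded by `r` on two `1 / 2`-nets: passing
from a net to the ball costs a factor `2` in each argument. -/
theorem opNorm_le_of_net [DecidableEq κ] {A : Matrix ι κ ℝ} {S : Finset (ι → ℝ)}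
    {T : Finset (κ → ℝ)}
    (hS : ∀ x, l2norm x ≤ 1 → ∃ t ∈ S, l2norm (x - t) ≤ 1 / 2)
    (hT : ∀ x, l2norm x ≤ 1 → ∃ t ∈ T, l2norm (x - t) ≤ 1 / 2) {r : ℝ} (hr : 0 ≤ r)
    (h : ∀ u ∈ S, ∀ v ∈ T, |u ⬝ᵥ A *ᵥ v| ≤ r) : ‖A‖ ≤ 4 * r := by
  have h1 : ∀ v ∈ T, l2norm (A *ᵥ v) ≤ 2 * r := by
    intro v hv
    set z := A *ᵥ v with hz
    by_cases hz0 : l2norm z = 0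
    · rw [hz0]; positivity
    obtain ⟨t, ht, hxt⟩ := hS _ (l2norm_inv_smul hz0).le
    have e : l2norm z = t ⬝ᵥ z + ((l2norm z)⁻¹ • z - t) ⬝ᵥ z := by
      rw [sub_dotProduct, smul_dotProduct, ← l2norm_sq, smul_eq_mul]
      field_simp; ring
    have a1 := (le_abs_self _).trans (h t ht v hv)
    have a2 := (le_abs_self _).trans (abs_dotProduct_le ((l2norm z)⁻¹ • z - t) z)
    have a3 : l2norm ((l2norm z)⁻¹ • z - t) * l2norm z ≤ 1 / 2 * l2norm z := by gcongr
    linarith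
  have h2 : ‖A‖ ≤ 2 * r + ‖A‖ / 2 := by
    refine opNorm_le_of_mulVec (by positivity) fun x => ?_
    by_cases hx0 : l2norm x = 0
    · have := l2norm_mulVec_le A x
      rw [hx0] at this ⊢; simpa using this
    obtain ⟨t, ht, hxt⟩ := hT _ (l2norm_inv_smul hx0).le
    have e : A *ᵥ x = l2norm x • (A *ᵥ t + A *ᵥ ((l2norm x)⁻¹ • x - t)) := by
      rw [← mulVec_add, add_sub_cancel, mulVec_smul, smul_smul, mul_inv_cancel₀ hx0, one_smul]
    rw [e, l2norm, WithLp.toLp_smul, norm_smul, norm_norm, WithLp.toLp_add, mul_comm]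
    gcongr
    refine (norm_add_le _ _).trans (add_le_add (h1 t ht) ?_)
    refine (l2norm_mulVec_le A _).trans ?_
    calc _ ≤ ‖A‖ * (1 / 2) := by gcongr
      _ = _ := by ring
  linarith

end Norms

/-! ### Sample cross-moment matrices -/

section CrossMoment

variable {Ω : Type*} [MeasurableSpace Ω] {μ : Measure Ω}

/-- Products of sub-Gaussian variables are subexponential. -/
theorem lintegral_exp_abs_mul_le {U V : Ω → ℝ} (hU : Measurable U) (hV : Measurable V)
    {κ : ℝ}
    (h1 : ∫⁻ ω, ENNReal.ofReal (Real.exp (U ω ^ 2 / κ ^ 2)) ∂μ ≤ 2)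
    (h2 : ∫⁻ ω, ENNReal.ofReal (Real.exp (V ω ^ 2 / κ ^ 2)) ∂μ ≤ 2) :
    ∫⁻ ω, ENNReal.ofReal (Real.exp |U ω * V ω / κ ^ 2|) ∂μ ≤ 2 := by
  have key : ∀ a b : ℝ, Real.exp |a * b / κ ^ 2| ≤
      2⁻¹ * Real.exp (a ^ 2 / κ ^ 2) + 2⁻¹ * Real.exp (b ^ 2 / κ ^ 2) := by
    intro a b
    have h : |a * b / κ ^ 2| ≤ 2⁻¹ * (a ^ 2 / κ ^ 2) + 2⁻¹ * (b ^ 2 / κ ^ 2) := by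
      rw [abs_div, abs_of_nonneg (sq_nonneg κ), abs_mul]
      have : |a| * |b| ≤ 2⁻¹ * a ^ 2 + 2⁻¹ * b ^ 2 := by
        nlinarith [sq_nonneg (|a| - |b|), sq_abs a, sq_abs b]
      calc |a| * |b| / κ ^ 2 ≤ (2⁻¹ * a ^ 2 + 2⁻¹ * b ^ 2) / κ ^ 2 := by gcongr
        _ = _ := by ring
    refine (Real.exp_le_exp.2 h).trans ?_
    simpa using convexOn_exp.2 (Set.mem_univ (a ^ 2 / κ ^ 2)) (Set.mem_univ (b ^ 2 / κ ^ 2))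
      (show (0 : ℝ) ≤ 2⁻¹ by norm_num) (show (0 : ℝ) ≤ 2⁻¹ by norm_num) (by norm_num)
  calc _ ≤ ∫⁻ ω, (ENNReal.ofReal 2⁻¹ * ENNReal.ofReal (Real.exp (U ω ^ 2 / κ ^ 2)) +
        ENNReal.ofReal 2⁻¹ * ENNReal.ofReal (Real.exp (V ω ^ 2 / κ ^ 2))) ∂μ := by
        refine lintegral_mono fun ω => ?_
        rw [← ENNReal.ofReal_mul (by norm_num), ← ENNReal.ofReal_mul (by norm_num),
          ← ENNReal.ofReal_add (by positivity) (by positivity)]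
        exact ENNReal.ofReal_le_ofReal (key _ _)
    _ = ENNReal.ofReal 2⁻¹ * ∫⁻ ω, ENNReal.ofReal (Real.exp (U ω ^ 2 / κ ^ 2)) ∂μ +
        ENNReal.ofReal 2⁻¹ * ∫⁻ ω, ENNReal.ofReal (Real.exp (V ω ^ 2 / κ ^ 2)) ∂μ := by
        rw [lintegral_add_left (by fun_prop), lintegral_const_mul _ (by fun_prop),
          lintegral_const_mul _ (by fun_prop)]
    _ ≤ ENNReal.ofReal 2⁻¹ * 2 + ENNReal.ofReal 2⁻¹ * 2 := by gcongr
    _ = 2 := by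
        rw [← ENNReal.ofReal_ofNat 2, ← ENNReal.ofReal_mul (by norm_num),
          ← ENNReal.ofReal_add (by norm_num) (by norm_num)]
        norm_num

/-- The deviation `17 √(n/N)` beats the `25 ^ n` pairs of points of the two nets: `17 ^ 2 = 289`,
and `64` is the constant in Bernstein's inequality. -/
theorem twentyFive_mul_exp_one_le : 25 * Real.exp 1 ≤ Real.exp (289 / 64) := by
  have h1 := Real.exp_one_gt_d9
  have h2 : Real.exp (289 / 64) = Real.exp 1 * (Real.exp 1 ^ 3 * Real.exp (33 / 64)) := by
    rw [← Real.exp_nat_mul, ← Real.exp_add, ← Real.exp_add]; norm_num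
  have h3 := Real.add_one_le_exp (33 / 64 : ℝ)
  have h4 : (2.7 : ℝ) ^ 3 ≤ Real.exp 1 ^ 3 := by gcongr; linarith
  have h5 : (2.7 : ℝ) ^ 3 * (97 / 64) ≤ Real.exp 1 ^ 3 * Real.exp (33 / 64) := by
    gcongr; linarith
  rw [h2, mul_comm]
  gcongr
  refine le_trans (by norm_num) h5

variable {ι ι' : Type*} [Fintype ι] [Fintype ι'] {N : ℕ}

theorem dotProduct_vecMulVec_mulVec (u p : ι → ℝ) (q v : ι' → ℝ) :
    u ⬝ᵥ vecMulVec p q *ᵥ v = (u ⬝ᵥ p) * (v ⬝ᵥ q) := by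
  rw [vecMulVec_mulVec, dotProduct_smul, dotProduct_comm q v]
  simp

/-- Concentration of the sample cross-moment matrix `N⁻¹ ∑ P i (Q i)ᵀ` of independent
sub-Gaussian pairs in operator norm: Bernstein's inequality at the points of `1 / 2`-nets of both
unit balls, and a union bound. -/
theorem crossMoment_concentration [IsProbabilityMeasure μ] [DecidableEq ι']
    {P : Fin N → Ω → ι → ℝ} {Q : Fin N → Ω → ι' → ℝ} {M : Matrix ι ι' ℝ} {κ : ℝ} {n : ℕ}
    (hκ : 0 < κ) (hN : 0 < N) (hdim : Fintype.card ι + Fintype.card ι' ≤ 2 * n)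
    (hn : 17 * Real.sqrt (n / N) ≤ 16)
    (hPm : ∀ i, Measurable (P i)) (hQm : ∀ i, Measurable (Q i))
    (hind : iIndepFun (fun i ω => (P i ω, Q i ω)) μ)
    (hP : ∀ i u, l2norm u ≤ 1 →
      ∫⁻ ω, ENNReal.ofReal (Real.exp ((u ⬝ᵥ P i ω) ^ 2 / κ ^ 2)) ∂μ ≤ 2)
    (hQ : ∀ i v, l2norm v ≤ 1 →
      ∫⁻ ω, ENNReal.ofReal (Real.exp ((v ⬝ᵥ Q i ω) ^ 2 / κ ^ 2)) ∂μ ≤ 2)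
    (hM : ∀ i u v, l2norm u ≤ 1 → l2norm v ≤ 1 →
      ∫ ω, (u ⬝ᵥ P i ω) * (v ⬝ᵥ Q i ω) ∂μ = u ⬝ᵥ M *ᵥ v) :
    μ {ω | 68 * κ ^ 2 * Real.sqrt (n / N) <
        ‖(N : ℝ)⁻¹ • ∑ i, vecMulVec (P i ω) (Q i ω) - M‖} ≤
      ENNReal.ofReal (2 * Real.exp (-(n : ℝ))) := by
  obtain ⟨S, hSc, hS1, hS⟩ := exists_net ι
  obtain ⟨T, hTc, hT1, hT⟩ := exists_net ι'
  set s : ℝ := 17 * Real.sqrt (n / N) with hs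
  have hs0 : 0 ≤ s := by positivity
  have hN' : (0 : ℝ) < N := by exact_mod_cast hN
  let Y : (ι → ℝ) → (ι' → ℝ) → Fin N → Ω → ℝ :=
    fun u v i ω => (u ⬝ᵥ P i ω) * (v ⬝ᵥ Q i ω) / κ ^ 2
  have hUm : ∀ (u : ι → ℝ) i, Measurable fun ω => u ⬝ᵥ P i ω := fun u i => by
    simp only [dotProduct]
    exact Finset.measurable_sum _ fun j _ => ((measurable_pi_apply j).comp (hPm i)).const_mul _
  have hVm : ∀ (v : ι' → ℝ) i, Measurable fun ω => v ⬝ᵥ Q i ω := fun v i => by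
    simp only [dotProduct]
    exact Finset.measurable_sum _ fun j _ => ((measurable_pi_apply j).comp (hQm i)).const_mul _
  let A : (ι → ℝ) → (ι' → ℝ) → Set Ω := fun u v =>
    {ω | N * s ≤ |∑ i, (Y u v i ω - ∫ ω', Y u v i ω' ∂μ)|}
  have hbern : ∀ u ∈ S, ∀ v ∈ T, μ.real (A u v) ≤ 2 * Real.exp (-(N * s ^ 2 / 64)) := by
    intro u hu v hv
    refine measure_abs_sum_ge_le (fun i => ((hUm u i).mul (hVm v i)).div_const _) ?_
      (fun i => lintegral_exp_abs_mul_le (hUm u i) (hVm v i) (hP i u (hS1 u hu))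
        (hQ i v (hT1 v hv))) hs0 hn
    refine hind.comp (fun i z => (u ⬝ᵥ z.1) * (v ⬝ᵥ z.2) / κ ^ 2) fun i => ?_
    simp only [dotProduct]
    fun_prop
  have hsub : {ω | 68 * κ ^ 2 * Real.sqrt (n / N) <
        ‖(N : ℝ)⁻¹ • ∑ i, vecMulVec (P i ω) (Q i ω) - M‖} ⊆ ⋃ z ∈ S ×ˢ T, A z.1 z.2 := by
    intro ω hω
    by_contra hcon
    simp only [Set.mem_iUnion, not_exists] at hcon
    rw [Set.mem_ofPred_eq] at hω
    refine absurd hω (not_lt.2 ?_)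
    have h4 : 68 * κ ^ 2 * Real.sqrt (n / N) = 4 * (κ ^ 2 * s) := by rw [hs]; ring
    rw [h4]
    refine opNorm_le_of_net hS hT (by positivity) fun u hu v hv => ?_
    have h5 : |∑ i, (Y u v i ω - ∫ ω', Y u v i ω' ∂μ)| ≤ N * s :=
      (not_le.1 (hcon (u, v) (Finset.mk_mem_product hu hv))).le
    have h6 : u ⬝ᵥ ((N : ℝ)⁻¹ • ∑ i, vecMulVec (P i ω) (Q i ω) - M) *ᵥ v =
        κ ^ 2 * ((N : ℝ)⁻¹ * ∑ i, (Y u v i ω - ∫ ω', Y u v i ω' ∂μ)) := by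
      have h7 : ∀ i, ∫ ω', Y u v i ω' ∂μ = u ⬝ᵥ M *ᵥ v / κ ^ 2 := fun i => by
        simp only [Y]
        rw [integral_div, hM i u v (hS1 u hu) (hT1 v hv)]
      simp only [h7, Finset.sum_sub_distrib, Y, ← Finset.sum_div, Finset.sum_const,
        Finset.card_univ, Fintype.card_fin, nsmul_eq_mul]
      rw [sub_mulVec, dotProduct_sub, smul_mulVec, dotProduct_smul, sum_mulVec, dotProduct_sum,
        smul_eq_mul]
      simp only [dotProduct_vecMulVec_mulVec]
      field_simp
    rw [h6, abs_mul, abs_mul, abs_of_nonneg (sq_nonneg κ), abs_of_pos (inv_pos.2 hN')]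
    gcongr
    rw [inv_mul_le_iff₀ hN']
    exact h5
  have hexp : (N : ℝ) * s ^ 2 / 64 = n * (289 / 64) := by
    rw [hs, mul_pow, Real.sq_sqrt (by positivity)]
    field_simp; ring
  have hfin : μ.real {ω | 68 * κ ^ 2 * Real.sqrt (n / N) <
        ‖(N : ℝ)⁻¹ • ∑ i, vecMulVec (P i ω) (Q i ω) - M‖} ≤ 2 * Real.exp (-(n : ℝ)) := by
    calc _ ≤ μ.real (⋃ z ∈ S ×ˢ T, A z.1 z.2) := measureReal_mono hsub (measure_ne_top μ _)
      _ ≤ ∑ z ∈ S ×ˢ T, μ.real (A z.1 z.2) := measureReal_biUnion_finset_le _ _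
      _ ≤ ∑ z ∈ S ×ˢ T, 2 * Real.exp (-(N * s ^ 2 / 64)) :=
          Finset.sum_le_sum fun z hz => hbern _ (Finset.mem_product.1 hz).1 _
            (Finset.mem_product.1 hz).2
      _ = ((S.card * T.card : ℕ) : ℝ) * (2 * Real.exp (-(n * (289 / 64)))) := by
          rw [Finset.sum_const, Finset.card_product, nsmul_eq_mul, hexp]
      _ ≤ (25 : ℝ) ^ n * (2 * Real.exp (-(n * (289 / 64)))) := by
          gcongr
          calc ((S.card * T.card : ℕ) : ℝ) ≤ ((5 ^ (2 * n) : ℕ) : ℝ) := by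
                norm_cast
                calc _ ≤ 5 ^ Fintype.card ι * 5 ^ Fintype.card ι' := Nat.mul_le_mul hSc hTc
                  _ = 5 ^ (Fintype.card ι + Fintype.card ι') := (pow_add _ _ _).symm
                  _ ≤ _ := Nat.pow_le_pow_right (by norm_num) hdim
            _ = 25 ^ n := by rw [pow_mul]; norm_num
      _ ≤ 2 * Real.exp (-(n : ℝ)) := by
          have h8 : (25 * Real.exp 1) ^ n ≤ Real.exp (n * (289 / 64)) := by
            rw [Real.exp_nat_mul]
            exact pow_le_pow_left₀ (by positivity) twentyFive_mul_exp_one_le n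
          rw [mul_pow, ← Real.exp_nat_mul, mul_one] at h8
          rw [Real.exp_neg, Real.exp_neg]
          generalize (n : ℝ) * (289 / 64) = c at h8 ⊢
          have h9 := Real.exp_pos (n : ℝ)
          have h10 := Real.exp_pos c
          field_simp
          linarith
  rw [← ENNReal.ofReal_toReal (measure_ne_top μ _)]
  exact ENNReal.ofReal_le_ofReal hfin

end CrossMoment

/-! ### Orthonormal columns and spectral decompositions -/

section Orthonormal

variable {ι κ : Type*} [Fintype ι] [Fintype κ]

theorem dotProduct_transpose_mul_mulVec (A : Matrix ι κ ℝ) (v : κ → ℝ) :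
    v ⬝ᵥ (Aᵀ * A) *ᵥ v = l2norm (A *ᵥ v) ^ 2 := by
  rw [l2norm_sq, ← mulVec_mulVec, dotProduct_mulVec, vecMul_transpose]

theorem l2norm_mulVec_of_orthonormal [DecidableEq κ] {A : Matrix ι κ ℝ} (hA : Aᵀ * A = 1)
    (v : κ → ℝ) : l2norm (A *ᵥ v) = l2norm v := by
  have := dotProduct_transpose_mul_mulVec A v
  rw [hA, one_mulVec, ← l2norm_sq] at this
  exact ((sq_eq_sq₀ (norm_nonneg _) (norm_nonneg _)).1 this).symm

theorem opNorm_le_one_of_orthonormal [DecidableEq κ] {A : Matrix ι κ ℝ} (hA : Aᵀ * A = 1) :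
    ‖A‖ ≤ 1 :=
  opNorm_le_of_mulVec zero_le_one fun v => by rw [l2norm_mulVec_of_orthonormal hA, one_mul]

theorem l2norm_diagonal_sq [DecidableEq κ] (f : κ → ℝ) (v : κ → ℝ) :
    l2norm (diagonal f *ᵥ v) ^ 2 = ∑ k, f k ^ 2 * v k ^ 2 := by
  rw [l2norm_sq]
  simp only [dotProduct, mulVec_diagonal]
  exact Finset.sum_congr rfl fun k _ => by ring

theorem l2norm_sq_eq_sum (v : κ → ℝ) : l2norm v ^ 2 = ∑ k, v k ^ 2 := by
  rw [l2norm_sq]; simp [dotProduct, sq]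

theorem le_l2norm_diagonal [DecidableEq κ] {f : κ → ℝ} {b : ℝ} (hb : 0 ≤ b) (hf : ∀ k, b ≤ f k)
    (v : κ → ℝ) : b * l2norm v ≤ l2norm (diagonal f *ᵥ v) := by
  refine le_of_sq_le_sq ?_ (norm_nonneg _)
  rw [l2norm_diagonal_sq, mul_pow, l2norm_sq_eq_sum, Finset.mul_sum]
  gcongr with k
  exact hf k

theorem exists_mulVec_eq_zero_of_card_lt (A : Matrix ι κ ℝ)
    (h : Fintype.card ι < Fintype.card κ) : ∃ v, v ≠ 0 ∧ A *ᵥ v = 0 := by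
  have := LinearMap.ker_ne_bot_of_finrank_lt (f := A.mulVecLin) (by simpa using h)
  obtain ⟨v, hv, hv0⟩ := Submodule.exists_mem_ne_zero_of_ne_bot this
  exact ⟨v, hv0, by simpa using hv⟩

theorem l2norm_pos {v : ι → ℝ} (hv : v ≠ 0) : 0 < l2norm v := by
  rw [l2norm, norm_pos_iff]
  simpa using hv

end Orthonormal

section Columns

variable {m : ℕ} {V : Matrix (Fin m) (Fin m) ℝ}

/-- The matrix of the first `d` columns of `V`. -/
def keepCols (d : ℕ) (V : Matrix (Fin m) (Fin m) ℝ) :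
    Matrix (Fin m) {k : Fin m // (k : ℕ) < d} ℝ :=
  V.submatrix id Subtype.val

theorem submatrix_orthonormal {κ : Type*} [DecidableEq κ] (hV : Vᵀ * V = 1) {f : κ → Fin m}
    (hf : Function.Injective f) : (V.submatrix id f)ᵀ * V.submatrix id f = 1 := by
  have : (V.submatrix id f)ᵀ * V.submatrix id f = (Vᵀ * V).submatrix f f := rfl
  rw [this, hV, submatrix_one _ hf]

theorem keepCols_orthonormal (hV : Vᵀ * V = 1) (d : ℕ) :
    (keepCols d V)ᵀ * keepCols d V = 1 :=
  submatrix_orthonormal hV Subtype.val_injective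

theorem dropCols_orthonormal (hV : Vᵀ * V = 1) (d : ℕ) :
    (dropCols d V)ᵀ * dropCols d V = 1 :=
  submatrix_orthonormal hV Subtype.val_injective

theorem keepCols_add_dropCols (hV : Vᵀ * V = 1) (d : ℕ) :
    keepCols d V * (keepCols d V)ᵀ + dropCols d V * (dropCols d V)ᵀ = 1 := by
  rw [← mul_eq_one_comm.1 hV]
  ext i j
  simp only [Matrix.add_apply, Matrix.mul_apply, transpose_apply, keepCols, dropCols,
    submatrix_apply, id]
  rw [← Fintype.sum_subtype_add_sum_subtype (fun k : Fin m => (k : ℕ) < d)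
    (fun k => V i k * V j k)]
  congr 1
  exact Fintype.sum_equiv (Equiv.subtypeEquivRight fun k => not_lt.symm) _ _ fun _ => rfl

theorem dotProduct_diagonalized {lam : Fin m → ℝ} (w : Fin m → ℝ) :
    w ⬝ᵥ (V * diagonal lam * Vᵀ) *ᵥ w = ∑ k, lam k * (Vᵀ *ᵥ w) k ^ 2 := by
  rw [← mulVec_mulVec, ← mulVec_mulVec, dotProduct_mulVec, ← mulVec_transpose]
  simp only [dotProduct, mulVec_diagonal]
  exact Finset.sum_congr rfl fun k _ => by ring

theorem diagonalized_mul_submatrix {κ : Type*} [Fintype κ] [DecidableEq κ] (hV : Vᵀ * V = 1)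
    (lam : Fin m → ℝ) (f : κ → Fin m) :
    V * diagonal lam * Vᵀ * V.submatrix id f =
      V.submatrix id f * diagonal (lam ∘ f) := by
  have : V * diagonal lam * Vᵀ * V.submatrix id f =
      (V * diagonal lam * (Vᵀ * V)).submatrix id f := by
    rw [← Matrix.mul_assoc]; rfl
  rw [this, hV, Matrix.mul_one]
  ext i k
  simp [mul_diagonal]

theorem sub_dropCols_mulVec (hV : Vᵀ * V = 1) (d : ℕ) (w : Fin m → ℝ) :
    w - dropCols d V *ᵥ ((dropCols d V)ᵀ *ᵥ w) = keepCols d V *ᵥ ((keepCols d V)ᵀ *ᵥ w) := by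
  have := congrArg (· *ᵥ w) (keepCols_add_dropCols hV d)
  simp only [add_mulVec, one_mulVec, ← mulVec_mulVec] at this
  rw [sub_eq_iff_eq_add, this]

end Columns

/-! ### Singular values -/

section Singular

variable {p m : ℕ} {κ : Type*} [Fintype κ] [DecidableEq κ]

/-- `B = U diag(σ) Wᵀ` is a compact singular value decomposition, with orthonormal columns of `U`
and `W` indexed by `κ`, and all singular values are at least `b`. -/
structure IsSVD (B : Matrix (Fin p) (Fin m) ℝ) (U : Matrix (Fin p) κ ℝ) (σ : κ → ℝ)
    (W : Matrix (Fin m) κ ℝ) (b : ℝ) : Prop where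
  left : Uᵀ * U = 1
  right : Wᵀ * W = 1
  eq : B = U * diagonal σ * Wᵀ
  le : ∀ k, b ≤ σ k

variable {B E : Matrix (Fin p) (Fin m) ℝ} {U : Matrix (Fin p) κ ℝ} {σ : κ → ℝ}
  {W : Matrix (Fin m) κ ℝ} {b η : ℝ}

namespace IsSVD

theorem le_l2norm_mulVec (h : IsSVD B U σ W b) (hb : 0 ≤ b) (w : Fin m → ℝ) :
    b * l2norm (Wᵀ *ᵥ w) ≤ l2norm (B *ᵥ w) := by
  rw [h.eq, ← mulVec_mulVec, ← mulVec_mulVec, l2norm_mulVec_of_orthonormal h.left]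
  exact le_l2norm_diagonal hb h.le _

theorem le_l2norm_transpose_mulVec (h : IsSVD B U σ W b) (hb : 0 ≤ b) (w : Fin p → ℝ) :
    b * l2norm (Uᵀ *ᵥ w) ≤ l2norm (Bᵀ *ᵥ w) := by
  rw [h.eq, transpose_mul, transpose_mul, transpose_transpose, diagonal_transpose,
    ← mulVec_mulVec, ← mulVec_mulVec, l2norm_mulVec_of_orthonormal h.right]
  exact le_l2norm_diagonal hb h.le _

theorem mulVec_eq (h : IsSVD B U σ W b) (w : Fin m → ℝ) :
    B *ᵥ w = U *ᵥ (Uᵀ *ᵥ (B *ᵥ w)) := by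
  have : U * (Uᵀ * B) = B := by
    rw [h.eq, Matrix.mul_assoc U, ← Matrix.mul_assoc Uᵀ, h.left, Matrix.one_mul]
  rw [mulVec_mulVec, mulVec_mulVec, Matrix.mul_assoc, this]

theorem mulVec_eq_zero (h : IsSVD B U σ W b) {w : Fin m → ℝ} (hw : Wᵀ *ᵥ w = 0) :
    B *ᵥ w = 0 := by
  rw [h.eq, ← mulVec_mulVec, hw, mulVec_zero]

end IsSVD

variable {V : Matrix (Fin m) (Fin m) ℝ} {lam : Fin m → ℝ}

/-- Weyl's inequality for the small singular values: a vector in the span of the first `k + 1`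
eigenvectors is killed by the matrix `B` of rank at most `k`. -/
theorem eigenvalue_le_sq (h : IsSVD B U σ W b) (hE : ‖E‖ ≤ η) (hV : Vᵀ * V = 1)
    (hlam : Antitone lam) (hBE : (B + E)ᵀ * (B + E) = V * diagonal lam * Vᵀ) {k : Fin m}
    (hk : Fintype.card κ ≤ k) : lam k ≤ η ^ 2 := by
  obtain ⟨c, hc0, hc⟩ := exists_mulVec_eq_zero_of_card_lt (Wᵀ * keepCols (k + 1) V) (by
    rw [Fintype.card_fin_lt_of_le (by omega)]; omega)
  set Z := keepCols (k + 1) V with hZ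
  have hZo : Zᵀ * Z = 1 := keepCols_orthonormal hV _
  have h1 : (B + E) *ᵥ (Z *ᵥ c) = E *ᵥ (Z *ᵥ c) := by
    rw [add_mulVec, h.mulVec_eq_zero (by rwa [mulVec_mulVec]), zero_add]
  have h2 : l2norm ((B + E) *ᵥ (Z *ᵥ c)) ^ 2 = ∑ j, lam j.1 * c j ^ 2 := by
    have h3 := diagonalized_mul_submatrix hV lam
      (Subtype.val : {j : Fin m // (j : ℕ) < k + 1} → Fin m)
    change _ * Z = Z * _ at h3
    rw [← dotProduct_transpose_mul_mulVec, hBE, mulVec_mulVec, h3, ← mulVec_mulVec,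
      dotProduct_mulVec, ← mulVec_transpose, mulVec_mulVec, hZo, one_mulVec]
    simp only [dotProduct, mulVec_diagonal, Function.comp_apply]
    exact Finset.sum_congr rfl fun j _ => by ring
  have h4 : lam k * l2norm c ^ 2 ≤ η ^ 2 * l2norm c ^ 2 := by
    calc lam k * l2norm c ^ 2 ≤ ∑ j, lam j.1 * c j ^ 2 := by
          rw [l2norm_sq_eq_sum, Finset.mul_sum]
          gcongr with j
          exact hlam (Fin.le_def.2 (Nat.lt_succ_iff.1 j.2))
      _ = l2norm (E *ᵥ (Z *ᵥ c)) ^ 2 := by rw [← h2, h1]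
      _ ≤ (η * l2norm c) ^ 2 := by
          gcongr
          refine (l2norm_mulVec_le _ _).trans ?_
          rw [l2norm_mulVec_of_orthonormal hZo]
          gcongr
      _ = _ := mul_pow _ _ _
  exact le_of_mul_le_mul_right h4 (by have := l2norm_pos hc0; positivity)

/-- Weyl's inequality for the large singular values: a vector in the row space of `B` is
orthogonal to the first `k` eigenvectors. -/
theorem sq_le_eigenvalue (h : IsSVD B U σ W b) (hE : ‖E‖ ≤ η) (hη : η ≤ b) (hb : 0 ≤ b)
    (hV : Vᵀ * V = 1)
    (hlam : Antitone lam) (hBE : (B + E)ᵀ * (B + E) = V * diagonal lam * Vᵀ) {k : Fin m}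
    (hk : (k : ℕ) < Fintype.card κ) : (b - η) ^ 2 ≤ lam k := by
  obtain ⟨c, hc0, hc⟩ := exists_mulVec_eq_zero_of_card_lt ((keepCols k V)ᵀ * W) (by
    rw [Fintype.card_fin_lt_of_le (by omega)]; omega)
  have hn : l2norm (W *ᵥ c) = l2norm c := l2norm_mulVec_of_orthonormal h.right c
  have h1 : (b - η) * l2norm c ≤ l2norm ((B + E) *ᵥ (W *ᵥ c)) := by
    have h2 := h.le_l2norm_mulVec hb (W *ᵥ c)
    rw [mulVec_mulVec, h.right, one_mulVec] at h2
    have h3 : l2norm (E *ᵥ (W *ᵥ c)) ≤ η * l2norm c := by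
      refine (l2norm_mulVec_le _ _).trans ?_
      rw [hn]; gcongr
    have h4 : l2norm (B *ᵥ (W *ᵥ c)) - l2norm (E *ᵥ (W *ᵥ c)) ≤
        l2norm ((B + E) *ᵥ (W *ᵥ c)) := by
      rw [add_mulVec, l2norm, l2norm, l2norm, WithLp.toLp_add]
      have := norm_sub_le_norm_add (WithLp.toLp 2 (B *ᵥ (W *ᵥ c))) (WithLp.toLp 2 (E *ᵥ (W *ᵥ c)))
      linarith
    linarith
  have h5 : l2norm ((B + E) *ᵥ (W *ᵥ c)) ^ 2 ≤ lam k * l2norm c ^ 2 := by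
    have h6 : l2norm (Vᵀ *ᵥ (W *ᵥ c)) = l2norm c := by
      rw [l2norm_mulVec_of_orthonormal, hn]
      rw [transpose_transpose]; exact mul_eq_one_comm.1 hV
    rw [← dotProduct_transpose_mul_mulVec, hBE, dotProduct_diagonalized, ← h6, l2norm_sq_eq_sum,
      Finset.mul_sum]
    refine Finset.sum_le_sum fun j _ => ?_
    by_cases hj : (j : ℕ) < k
    · have : (Vᵀ *ᵥ (W *ᵥ c)) j = 0 := by
        rw [← mulVec_mulVec] at hc
        exact congrFun hc ⟨j, hj⟩
      rw [this]; simp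
    · gcongr
      exact hlam (Fin.le_def.2 (not_lt.1 hj))
  have h7 : (b - η) ^ 2 * l2norm c ^ 2 ≤ lam k * l2norm c ^ 2 := by
    rw [← mul_pow]
    refine le_trans ?_ h5
    have : 0 ≤ b - η := by linarith
    gcongr
  exact le_of_mul_le_mul_right h7 (by have := l2norm_pos hc0; positivity)

end Singular

/-! ### The singular value decomposition of the coefficient matrix -/

section SVD

theorem eigDesc_antitone {m : ℕ} {A : Matrix (Fin m) (Fin m) ℝ} (hA : A.IsHermitian) :
    Antitone (eigDesc hA) := fun _ _ h => hA.eigenvalues₀_antitone (by simpa using h)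

/-- The spectral theorem with the eigenvalues in decreasing order. -/
theorem exists_diagonalization {m : ℕ} {A : Matrix (Fin m) (Fin m) ℝ} (hA : A.IsHermitian) :
    ∃ V : Matrix (Fin m) (Fin m) ℝ, Vᵀ * V = 1 ∧ A = V * diagonal (eigDesc hA) * Vᵀ := by
  let g : Fin m ≃ Fin m :=
    (finCongr (Fintype.card_fin m).symm).trans (Fintype.equivOfCardEq (Fintype.card_fin _))
  have hg : ∀ k, hA.eigenvalues (g k) = eigDesc hA k := fun k => by
    simp only [IsHermitian.eigenvalues, g, Equiv.trans_apply, Equiv.symm_apply_apply]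
    rfl
  set Q : Matrix (Fin m) (Fin m) ℝ := (hA.eigenvectorUnitary).1 with hQ
  have hQ1 : Qᵀ * Q = 1 := by
    have := (mem_unitaryGroup_iff' (A := Q)).1 hA.eigenvectorUnitary.2
    rwa [star_eq_conjTranspose, conjTranspose_eq_transpose_of_trivial] at this
  have hA' : A = Q * diagonal hA.eigenvalues * Qᵀ := by
    have := hA.spectral_theorem
    rw [Unitary.conjStarAlgAut_apply] at this
    exact this
  refine ⟨Q.submatrix id g, submatrix_orthonormal hQ1 g.injective, ?_⟩
  have hd : diagonal (eigDesc hA) = (diagonal hA.eigenvalues).submatrix g g := by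
    rw [submatrix_diagonal _ _ g.injective]
    congr 1; ext k; exact (hg k).symm
  rw [hd, transpose_submatrix, submatrix_mul_equiv, submatrix_mul_equiv, submatrix_id_id]
  exact hA'

theorem eigDesc_gram_nonneg {p m : ℕ} (B : Matrix (Fin p) (Fin m) ℝ) (k : Fin m) :
    0 ≤ eigDesc (gram_isHermitian B) k := by
  have : (Bᵀ * B).PosSemidef := by
    rw [← conjTranspose_eq_transpose_of_trivial]; exact posSemidef_conjTranspose_mul_self B
  have h := this.eigenvalues_nonneg
  have h2 := h ((Fintype.equivOfCardEq (Fintype.card_fin _)) (Fin.cast (Fintype.card_fin m).symm k))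
  rw [IsHermitian.eigenvalues, Equiv.symm_apply_apply] at h2
  exact h2

/-- A Gram matrix of rank `d` has no non-zero eigenvalues beyond the `d`-th. -/
theorem eigDesc_gram_eq_zero {p m : ℕ} (B : Matrix (Fin p) (Fin m) ℝ) {k : Fin m}
    (hk : B.rank ≤ k) : eigDesc (gram_isHermitian B) k = 0 := by
  by_contra hne
  have hpos := lt_of_le_of_ne (eigDesc_gram_nonneg B k) (Ne.symm hne)
  obtain ⟨V, hV, hBV⟩ := exists_diagonalization (gram_isHermitian B)
  have hle : (k : ℕ) + 1 ≤ B.rank := by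
    rw [← rank_transpose_mul_self B, hBV, rank_mul_eq_left_of_isUnit_det,
      rank_mul_eq_right_of_isUnit_det, rank_diagonal]
    · rw [← Fintype.card_fin (k + 1)]
      refine Fintype.card_le_of_injective
        (fun j : Fin (k + 1) => ⟨⟨j, by omega⟩, ?_⟩) ?_
      · have hj : (⟨j, by omega⟩ : Fin m) ≤ k := Fin.le_def.2 (by simp; omega)
        exact (hpos.trans_le (eigDesc_antitone _ hj)).ne'
      · intro i j hij
        simpa [Fin.ext_iff] using hij
    · exact (isUnit_iff_isUnit_det _).1 (IsUnit.of_mul_eq_one _ (mul_eq_one_comm.1 hV))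
    · exact (isUnit_iff_isUnit_det _).1 (IsUnit.of_mul_eq_one _ hV)
  omega

/-- The compact singular value decomposition of the coefficient matrix: `W` holds the first `d`
eigenvectors of `Bᵀ B`, the `σ k` are the roots of the eigenvalues, and `U = B W diag(σ)⁻¹`. -/
theorem CoefficientCondition.exists_isSVD {p K d : ℕ} {B : Matrix (Fin p) (Fin (K + 1)) ℝ}
    {τmin τmax : ℝ} (h : CoefficientCondition B d τmin τmax) (hτ : 0 < τmin) :
    ∃ (U : Matrix (Fin p) {k : Fin (K + 1) // (k : ℕ) < d} ℝ) (σ : _ → ℝ) (W : _),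
      IsSVD B U σ W (Real.sqrt τmin) := by
  obtain ⟨V, hV, hBV⟩ := exists_diagonalization (gram_isHermitian B)
  set lam := eigDesc (gram_isHermitian B) with hlam
  have hanti : Antitone lam := eigDesc_antitone _
  set W := keepCols d V with hW
  have hWo : Wᵀ * W = 1 := keepCols_orthonormal hV d
  have hd := h.lt
  have hd1 := h.pos
  have hlow : ∀ k : {k : Fin (K + 1) // (k : ℕ) < d}, τmin ≤ lam k.1 := fun k =>
    (h.lower ⟨d - 1, by omega⟩ (by simp; omega)).trans
      (hanti (Fin.le_def.2 (by have := k.2; simp; omega)))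
  have hBT : B * dropCols d V = 0 := by
    rw [← conjTranspose_mul_self_eq_zero, conjTranspose_eq_transpose_of_trivial, transpose_mul,
      Matrix.mul_assoc, ← Matrix.mul_assoc Bᵀ, hBV, dropCols, diagonalized_mul_submatrix hV]
    have : lam ∘ (Subtype.val : {k : Fin (K + 1) // d ≤ (k : ℕ)} → _) = 0 := by
      ext k
      exact eigDesc_gram_eq_zero B (by rw [h.rank_eq]; exact k.2)
    rw [this]; simp
  have hBW : B * (W * Wᵀ) = B := by
    have := congrArg (B * ·) (keepCols_add_dropCols hV d)
    simpa only [Matrix.mul_add, ← Matrix.mul_assoc, hBT, Matrix.zero_mul, add_zero,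
      Matrix.mul_one] using this
  let σ : {k : Fin (K + 1) // (k : ℕ) < d} → ℝ := fun k => Real.sqrt (lam k.1)
  have hσ : ∀ k, 0 < σ k := fun k => Real.sqrt_pos.2 (hτ.trans_le (hlow k))
  refine ⟨B * W * diagonal σ⁻¹, σ, W, ?_, hWo, ?_, fun k => Real.sqrt_le_sqrt (hlow k)⟩
  · have h1 : Bᵀ * B * W =
        W * (diagonal (lam ∘ Subtype.val) : Matrix {k : Fin (K + 1) // (k : ℕ) < d} _ ℝ) := by
      rw [hBV]; exact diagonalized_mul_submatrix hV lam _
    have h2 : Wᵀ * Bᵀ * (B * W) =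
        (diagonal (lam ∘ Subtype.val) : Matrix {k : Fin (K + 1) // (k : ℕ) < d} _ ℝ) := by
      rw [Matrix.mul_assoc, ← Matrix.mul_assoc Bᵀ, h1, ← Matrix.mul_assoc, hWo, Matrix.one_mul]
    rw [transpose_mul, transpose_mul, diagonal_transpose, Matrix.mul_assoc,
      ← Matrix.mul_assoc (Wᵀ * Bᵀ), h2, diagonal_mul_diagonal, diagonal_mul_diagonal,
      ← diagonal_one]
    congr 1; ext k
    have h3 : σ k * σ k = lam k.1 := Real.mul_self_sqrt (hτ.trans_le (hlow k)).le
    have h4 := (hσ k).ne'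
    simp only [Pi.inv_apply, Function.comp_apply, ← h3]
    field_simp
  · rw [Matrix.mul_assoc (B * W), diagonal_mul_diagonal]
    have : (fun k => σ⁻¹ k * σ k) = fun _ => 1 := by
      ext k
      exact inv_mul_cancel₀ (hσ k).ne'
    rw [this, diagonal_one, Matrix.mul_one, Matrix.mul_assoc, hBW]

end SVD

/-! ### Deterministic perturbation bound -/

section Perturbation

variable {p m : ℕ} {κ : Type*} [Fintype κ] [DecidableEq κ]

theorem abs_dotProduct_mulVec_le {ι ι' : Type*} [Fintype ι] [Fintype ι'] [DecidableEq ι']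
    (A : Matrix ι ι' ℝ) (u : ι → ℝ) (v : ι' → ℝ) {a : ℝ} (hA : ‖A‖ ≤ a) :
    |u ⬝ᵥ A *ᵥ v| ≤ a * l2norm u * l2norm v := by
  refine (abs_dotProduct_le _ _).trans ?_
  calc _ ≤ l2norm u * (a * l2norm v) := by
        gcongr
        exact (l2norm_mulVec_le A v).trans (by gcongr)
    _ = _ := by ring

theorem l2norm_mulVec_le_of_le {ι ι' : Type*} [Fintype ι] [Fintype ι'] [DecidableEq ι']
    {A : Matrix ι ι' ℝ} {a : ℝ} (hA : ‖A‖ ≤ a) (v : ι' → ℝ) :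
    l2norm (A *ᵥ v) ≤ a * l2norm v :=
  (l2norm_mulVec_le A v).trans (by gcongr)

theorem l2norm_add_le {ι : Type*} [Fintype ι] (u v : ι → ℝ) :
    l2norm (u + v) ≤ l2norm u + l2norm v := by
  rw [l2norm, WithLp.toLp_add]; exact norm_add_le _ _

theorem l2norm_sub_le {ι : Type*} [Fintype ι] (u v : ι → ℝ) :
    l2norm (u - v) ≤ l2norm u + l2norm v := by
  rw [l2norm, WithLp.toLp_sub]; exact norm_sub_le _ _

/-- The columns of `V` are orthonormal, `B + E` is of size `η` on the span of all of them but the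
first `d`, and it is bounded below by `b / 2` on the span of the first `d`. This is what the
perturbation bound needs of the eigenvectors of `(B + E)ᵀ(B + E)`. In `large` the vector `w` is
arbitrary, since the images of the two spans under `B + E` are orthogonal. -/
structure IsNoiseSpace (B E : Matrix (Fin p) (Fin m) ℝ) (d : ℕ) (V : Matrix (Fin m) (Fin m) ℝ)
    (b η : ℝ) : Prop where
  orthonormal : Vᵀ * V = 1
  small : ∀ a, l2norm ((B + E) *ᵥ (dropCols d V *ᵥ a)) ≤ η * l2norm a
  gram_small : ∀ a, l2norm ((B + E)ᵀ *ᵥ ((B + E) *ᵥ (dropCols d V *ᵥ a))) ≤ η ^ 2 * l2norm a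
  large : ∀ w, b / 2 * l2norm ((keepCols d V)ᵀ *ᵥ w) ≤ l2norm ((B + E) *ᵥ w)

variable {B E : Matrix (Fin p) (Fin m) ℝ} {U : Matrix (Fin p) κ ℝ} {σ : κ → ℝ}
  {W : Matrix (Fin m) κ ℝ} {b η : ℝ} {V : Matrix (Fin m) (Fin m) ℝ} {d : ℕ}

theorem IsSVD.isNoiseSpace (h : IsSVD B U σ W b) (hd : Fintype.card κ = d) (hE : ‖E‖ ≤ η)
    (hη : η ≤ b / 2) (hV : IsOrderedEigenbasis ((B + E)ᵀ * (B + E)) V) :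
    IsNoiseSpace B E d V b η := by
  obtain ⟨hVo, lam, hlam, hBE⟩ := hV
  have hη0 : 0 ≤ η := (norm_nonneg _).trans hE
  have hb : 0 ≤ b := by linarith
  have hT : (dropCols d V)ᵀ * dropCols d V = 1 := dropCols_orthonormal hVo d
  have hdiag : (B + E)ᵀ * (B + E) * dropCols d V =
      dropCols d V * (diagonal (lam ∘ Subtype.val) : Matrix {k : Fin m // d ≤ (k : ℕ)} _ ℝ) := by
    rw [hBE]; exact diagonalized_mul_submatrix hVo lam _
  have hsum : ∀ w, l2norm ((B + E) *ᵥ w) ^ 2 = ∑ k, lam k * (Vᵀ *ᵥ w) k ^ 2 := fun w => by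
    rw [← dotProduct_transpose_mul_mulVec, hBE, dotProduct_diagonalized]
  have hsmall : ∀ a, l2norm ((B + E) *ᵥ (dropCols d V *ᵥ a)) ^ 2 = ∑ k, lam k.1 * a k ^ 2 := by
    intro a
    rw [← dotProduct_transpose_mul_mulVec, mulVec_mulVec, hdiag, ← mulVec_mulVec,
      dotProduct_mulVec, ← mulVec_transpose, mulVec_mulVec, hT, one_mulVec]
    simp only [dotProduct, mulVec_diagonal, Function.comp_apply]
    exact Finset.sum_congr rfl fun j _ => by ring
  have hle : ∀ k : {k : Fin m // d ≤ (k : ℕ)}, lam k.1 ≤ η ^ 2 := fun k =>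
    eigenvalue_le_sq h hE hVo hlam hBE (by rw [hd]; exact k.2)
  have hnn : ∀ k, 0 ≤ lam k := by
    intro k
    have h1 := hsum (V *ᵥ Pi.single k 1)
    rw [mulVec_mulVec (M := Vᵀ), hVo, one_mulVec] at h1
    have h2 : ∑ j, lam j * (Pi.single k 1 : Fin m → ℝ) j ^ 2 = lam k := by
      simp [Pi.single_apply]
    rw [← h2, ← h1]; positivity
  refine ⟨hVo, fun a => ?_, fun a => ?_, fun w => ?_⟩
  · refine le_of_sq_le_sq ?_ (by positivity)
    rw [hsmall, mul_pow, l2norm_sq_eq_sum, Finset.mul_sum]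
    gcongr with k
    exact hle k
  · rw [mulVec_mulVec, mulVec_mulVec, hdiag, ← mulVec_mulVec, l2norm_mulVec_of_orthonormal hT]
    refine le_of_sq_le_sq ?_ (by positivity)
    rw [l2norm_diagonal_sq, mul_pow, l2norm_sq_eq_sum, Finset.mul_sum]
    gcongr with k
    · exact hnn _
    · exact hle k
  · refine le_of_sq_le_sq ?_ (by positivity)
    rw [hsum, mul_pow, l2norm_sq_eq_sum, Finset.mul_sum]
    calc ∑ k : {k : Fin m // (k : ℕ) < d}, (b / 2) ^ 2 * ((keepCols d V)ᵀ *ᵥ w) k ^ 2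
        ≤ ∑ k : {k : Fin m // (k : ℕ) < d}, lam k.1 * (Vᵀ *ᵥ w) k.1 ^ 2 := by
          refine Finset.sum_le_sum fun k _ => ?_
          have h1 : ((keepCols d V)ᵀ *ᵥ w) k = (Vᵀ *ᵥ w) k.1 := rfl
          rw [h1]
          gcongr
          refine le_trans ?_ (sq_le_eigenvalue h hE (by linarith) hb hVo hlam hBE (k := k.1)
            (by rw [hd]; exact k.2))
          gcongr
          linarith
      _ ≤ _ := by
          rw [← Fintype.sum_subtype_add_sum_subtype (fun k : Fin m => (k : ℕ) < d)
            (fun k => lam k * (Vᵀ *ᵥ w) k ^ 2)]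
          have : 0 ≤ ∑ k : {k : Fin m // ¬ (k : ℕ) < d}, lam k.1 * (Vᵀ *ᵥ w) k.1 ^ 2 :=
            Finset.sum_nonneg fun k _ => mul_nonneg (hnn _) (sq_nonneg _)
          linarith

/-- Perturbation bound for minimum-variance weights. `w` minimizes the quadratic form of `S` over
`e + ker B`, and `w'` minimizes that of `S'` over `e` plus the estimated null space. The error
`(B + E)(w' - w)` is of second order in `‖E‖` except for the part `UᵀE` of `E` in the column
space of `B`. -/
theorem l2norm_perturbed_weight_sub_le (h : IsSVD B U σ W b) (hb : 0 < b)
    (hN : IsNoiseSpace B E d V b η) (hE : ‖E‖ ≤ η) {δ : ℝ} (hUE : ‖Uᵀ * E‖ ≤ δ)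
    {S S' : Matrix (Fin m) (Fin m) ℝ} {τ τ' ρ : ℝ} (hτ : 0 < τ) (hττ : τ ≤ τ')
    (hS : ∀ v, τ * l2norm v ^ 2 ≤ v ⬝ᵥ S *ᵥ v) (hS' : ‖S‖ ≤ τ') (hρ : ‖S' - S‖ ≤ ρ)
    (hρτ : ρ ≤ τ / 2) {e w w' : Fin m → ℝ} {a : {k : Fin m // d ≤ (k : ℕ)} → ℝ}
    (he : l2norm e = 1) (hw : B *ᵥ w = B *ᵥ e)
    (hopt : ∀ v, B *ᵥ v = 0 → v ⬝ᵥ S *ᵥ w = 0) (hw' : w' = e - dropCols d V *ᵥ a)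
    (hopt' : (dropCols d V)ᵀ *ᵥ (S' *ᵥ w') = 0) :
    l2norm ((B + E) *ᵥ (w' - w)) ≤ (1 + 4 * τ' / τ) * (2 * η ^ 2 / b + δ) +
      η * ((1 + 4 * τ' / τ) * (2 * η / b + (6 * τ' * η / b + ρ) / τ)) := by
  set T := dropCols d V with hT
  have hTo : Tᵀ * T = 1 := dropCols_orthonormal hN.orthonormal d
  set u := T *ᵥ a with hu
  set M : ℝ := 1 + 4 * τ' / τ with hM
  have hη : 0 ≤ η := (norm_nonneg _).trans hE
  have hρ0 : 0 ≤ ρ := (norm_nonneg _).trans hρ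
  have hδ0 : 0 ≤ δ := (norm_nonneg _).trans hUE
  have hτ' : 0 < τ' := hτ.trans_le hττ
  have hSn : ‖S'‖ ≤ 2 * τ' := by
    have : ‖S'‖ ≤ ‖S' - S‖ + ‖S‖ := by simpa using norm_add_le (S' - S) S
    linarith
  -- the estimated weights are bounded
  have horth : ∀ c, (T *ᵥ c) ⬝ᵥ S' *ᵥ w' = 0 := fun c => by
    rw [← vecMul_transpose, ← dotProduct_mulVec, hopt', dotProduct_zero]
  have hwn : l2norm w' ≤ 4 * τ' / τ := by
    have h1 : τ / 2 * l2norm w' ^ 2 ≤ w' ⬝ᵥ S' *ᵥ w' := by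
      have h2 := hS w'
      have h3 := abs_le.1 (abs_dotProduct_mulVec_le (S' - S) w' w' hρ)
      rw [sub_mulVec, dotProduct_sub] at h3
      have h4 : ρ * l2norm w' * l2norm w' ≤ τ / 2 * l2norm w' * l2norm w' := by gcongr
      nlinarith [h3.1]
    have h5 : w' ⬝ᵥ S' *ᵥ w' = e ⬝ᵥ S' *ᵥ w' := by
      conv_lhs => rw [show w' ⬝ᵥ S' *ᵥ w' = (e - u) ⬝ᵥ S' *ᵥ w' by rw [← hw']]
      rw [sub_dotProduct, hu, horth, sub_zero]
    have h6 := (le_abs_self _).trans (abs_dotProduct_mulVec_le S' e w' hSn)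
    rw [he] at h6
    rcases (norm_nonneg (WithLp.toLp 2 w')).eq_or_lt with h0 | h0
    · rw [l2norm, ← h0]; positivity
    · rw [le_div_iff₀ hτ]
      refine le_of_mul_le_mul_right ?_ h0
      change l2norm w' * τ * l2norm w' ≤ 4 * τ' * l2norm w'
      nlinarith
  have hun : l2norm u ≤ M := by
    have : u = e - w' := by rw [hw']; abel
    rw [this]
    linarith [l2norm_sub_le e w']
  have han : l2norm a ≤ M := by rwa [hu, l2norm_mulVec_of_orthonormal hTo] at hun
  have hwM : l2norm w' ≤ M := by linarith
  have hM0 : 0 ≤ M := (norm_nonneg _).trans hwM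
  -- the estimated null space is nearly annihilated by `B`
  have hBu' : l2norm (B *ᵥ u) ≤ 2 * η * M := by
    have h1 : B *ᵥ u = (B + E) *ᵥ u - E *ᵥ u := by rw [add_mulVec]; abel
    have h2 := hN.small a
    have h3 := l2norm_mulVec_le_of_le hE u
    rw [h1]
    refine (l2norm_sub_le _ _).trans ?_
    have h4 : η * l2norm a ≤ η * M := by gcongr
    have h5 : η * l2norm u ≤ η * M := by gcongr
    linarith
  have hBu : l2norm (B *ᵥ u) ≤ M * (2 * η ^ 2 / b + δ) := by
    have h1 : l2norm (Bᵀ *ᵥ ((B + E) *ᵥ u)) ≤ 2 * η ^ 2 * M := by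
      have h2 : Bᵀ *ᵥ ((B + E) *ᵥ u) =
          (B + E)ᵀ *ᵥ ((B + E) *ᵥ u) - Eᵀ *ᵥ ((B + E) *ᵥ u) := by
        rw [transpose_add, add_mulVec Bᵀ Eᵀ, add_sub_cancel_right]
      rw [h2]
      refine (l2norm_sub_le _ _).trans ?_
      have h3 := hN.gram_small a
      have h4 := l2norm_mulVec_le_of_le (A := Eᵀ) (a := η) (by rwa [opNorm_transpose])
        ((B + E) *ᵥ u)
      have h5 : η ^ 2 * l2norm a ≤ η ^ 2 * M := by gcongr
      have h6 : η * l2norm ((B + E) *ᵥ u) ≤ η * (η * M) := by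
        gcongr; exact (hN.small a).trans (by gcongr)
      linarith
    have h7 : l2norm (Uᵀ *ᵥ ((B + E) *ᵥ u)) ≤ 2 * η ^ 2 * M / b := by
      rw [le_div_iff₀ hb]
      linarith [h.le_l2norm_transpose_mulVec hb.le ((B + E) *ᵥ u)]
    have h8 : Uᵀ *ᵥ (B *ᵥ u) = Uᵀ *ᵥ ((B + E) *ᵥ u) - (Uᵀ * E) *ᵥ u := by
      rw [add_mulVec, mulVec_add, ← mulVec_mulVec u Uᵀ E]; abel
    rw [h.mulVec_eq, l2norm_mulVec_of_orthonormal h.left, h8]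
    refine (l2norm_sub_le _ _).trans ?_
    have h9 : l2norm ((Uᵀ * E) *ᵥ u) ≤ δ * M :=
      (l2norm_mulVec_le_of_le hUE u).trans (by gcongr)
    calc _ ≤ 2 * η ^ 2 * M / b + δ * M := add_le_add h7 h9
      _ = _ := by ring
  -- comparison of `e - w` with the projection of `u = e - w'` to `ker B`
  set q := W *ᵥ (Wᵀ *ᵥ u) with hq
  set v := u - q - (e - w) with hv
  have hqn : l2norm q ≤ 2 * η / b * M := by
    rw [hq, l2norm_mulVec_of_orthonormal h.right, div_mul_eq_mul_div, le_div_iff₀ hb]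
    linarith [h.le_l2norm_mulVec hb.le u]
  have hBq : B *ᵥ q = B *ᵥ u := by
    have : Wᵀ *ᵥ (u - q) = 0 := by
      rw [mulVec_sub, hq, mulVec_mulVec _ Wᵀ W, h.right, one_mulVec, sub_self]
    have := h.mulVec_eq_zero this
    rw [mulVec_sub, sub_eq_zero] at this
    exact this.symm
  have hBv : B *ᵥ v = 0 := by
    rw [hv, mulVec_sub, mulVec_sub, mulVec_sub, hBq, hw]; simp
  clear_value v
  have hZv : l2norm (v - T *ᵥ (Tᵀ *ᵥ v)) ≤ 2 * η / b * l2norm v := by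
    rw [hT, sub_dropCols_mulVec hN.orthonormal, l2norm_mulVec_of_orthonormal
      (keepCols_orthonormal hN.orthonormal d), div_mul_eq_mul_div, le_div_iff₀ hb]
    have h1 := hN.large v
    rw [add_mulVec, hBv, zero_add] at h1
    have h2 := l2norm_mulVec_le_of_le hE v
    linarith
  have hvn : l2norm v ≤ M * ((6 * τ' * η / b + ρ) / τ) := by
    have h1 : v ⬝ᵥ S *ᵥ v = -(v ⬝ᵥ S *ᵥ q) + v ⬝ᵥ (S' - S) *ᵥ w' -
        (v - T *ᵥ (Tᵀ *ᵥ v)) ⬝ᵥ S' *ᵥ w' := by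
      have h2 : v = w - q - w' := by rw [hv, hw']; abel
      rw [sub_dotProduct, horth, sub_mulVec, dotProduct_sub]
      conv_lhs => rw [show v ⬝ᵥ S *ᵥ v = v ⬝ᵥ S *ᵥ (w - q - w') by rw [← h2]]
      rw [mulVec_sub, mulVec_sub, dotProduct_sub, dotProduct_sub, hopt v hBv]
      ring
    have h2 := abs_le.1 (abs_dotProduct_mulVec_le S v q hS')
    have h3 := abs_le.1 (abs_dotProduct_mulVec_le (S' - S) v w' hρ)
    have h4 := abs_le.1 (abs_dotProduct_mulVec_le S' (v - T *ᵥ (Tᵀ *ᵥ v)) w' hSn)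
    have h5 : τ' * l2norm v * l2norm q ≤ τ' * l2norm v * (2 * η / b * M) := by gcongr
    have h6 : ρ * l2norm v * l2norm w' ≤ ρ * l2norm v * M := by gcongr
    have h7 : 2 * τ' * l2norm (v - T *ᵥ (Tᵀ *ᵥ v)) * l2norm w' ≤
        2 * τ' * (2 * η / b * l2norm v) * M := by gcongr
    have h8 : τ * l2norm v ^ 2 ≤ M * (6 * τ' * η / b + ρ) * l2norm v := by
      calc τ * l2norm v ^ 2 ≤ v ⬝ᵥ S *ᵥ v := hS v
        _ ≤ τ' * l2norm v * (2 * η / b * M) + ρ * l2norm v * M +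
            2 * τ' * (2 * η / b * l2norm v) * M := by rw [h1]; linarith
        _ = _ := by ring
    rw [← mul_div_assoc, le_div_iff₀ hτ]
    rcases (norm_nonneg (WithLp.toLp 2 v)).eq_or_lt with h0 | h0
    · rw [l2norm, ← h0, zero_mul]; positivity
    · refine le_of_mul_le_mul_right ?_ h0
      change l2norm v * τ * l2norm v ≤ M * (6 * τ' * η / b + ρ) * l2norm v
      linarith
  have hdiff : l2norm (w' - w) ≤ M * (2 * η / b + (6 * τ' * η / b + ρ) / τ) := by
    have h1 : w' - w = -(q + v) := by rw [hv, hw']; abel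
    rw [h1, l2norm, WithLp.toLp_neg, norm_neg]
    refine (l2norm_add_le _ _).trans ?_
    calc _ ≤ 2 * η / b * M + M * ((6 * τ' * η / b + ρ) / τ) := add_le_add hqn hvn
      _ = _ := by ring
  have hfin : (B + E) *ᵥ (w' - w) = E *ᵥ (w' - w) - B *ᵥ u := by
    rw [add_mulVec, mulVec_sub B, hw, hw', mulVec_sub B]; abel
  rw [hfin]
  refine (l2norm_sub_le _ _).trans ?_
  have h1 := (l2norm_mulVec_le_of_le hE (w' - w)).trans (mul_le_mul_of_nonneg_left hdiff hη)
  linarith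

end Perturbation

/-! ### Positive definite matrices and optimal weights -/

section Coercive

variable {m : ℕ} {S : Matrix (Fin m) (Fin m) ℝ}

theorem EigenvaluesIn.eigDesc_mem {a b : ℝ} (h : EigenvaluesIn S a b) (hS : S.IsHermitian)
    (k : Fin m) : eigDesc hS k ∈ Set.Icc a b := by
  have h2 := h (hS.eigenvalues_mem_spectrum_real
    ((Fintype.equivOfCardEq (Fintype.card_fin _)) (Fin.cast (Fintype.card_fin m).symm k)))
  rwa [IsHermitian.eigenvalues, Equiv.symm_apply_apply] at h2

theorem EigenvaluesIn.mul_sq_le {a b : ℝ} (h : EigenvaluesIn S a b) (hS : S.IsHermitian)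
    (v : Fin m → ℝ) : a * l2norm v ^ 2 ≤ v ⬝ᵥ S *ᵥ v := by
  obtain ⟨V, hV, hSV⟩ := exists_diagonalization hS
  have h1 : l2norm (Vᵀ *ᵥ v) = l2norm v :=
    l2norm_mulVec_of_orthonormal (by rw [transpose_transpose]; exact mul_eq_one_comm.1 hV) v
  conv_rhs => rw [hSV]
  rw [dotProduct_diagonalized, ← h1, l2norm_sq_eq_sum, Finset.mul_sum]
  gcongr with k
  exact (h.eigDesc_mem hS k).1

theorem EigenvaluesIn.norm_le {a b : ℝ} (h : EigenvaluesIn S a b) (hS : S.IsHermitian)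
    (ha : 0 ≤ a) (hb : 0 ≤ b) : ‖S‖ ≤ b := by
  obtain ⟨V, hV, hSV⟩ := exists_diagonalization hS
  have h1 : ‖diagonal (eigDesc hS)‖ ≤ b := by
    rw [l2_opNorm_diagonal, pi_norm_le_iff_of_nonneg hb]
    intro k
    have := h.eigDesc_mem hS k
    rw [Real.norm_eq_abs, abs_of_nonneg (ha.trans this.1)]
    exact this.2
  have h2 := opNorm_le_one_of_orthonormal hV
  rw [hSV]
  calc _ ≤ ‖V * diagonal (eigDesc hS)‖ * ‖Vᵀ‖ := l2_opNorm_mul _ _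
    _ ≤ (‖V‖ * ‖diagonal (eigDesc hS)‖) * ‖V‖ := by
        rw [opNorm_transpose]; gcongr; exact l2_opNorm_mul _ _
    _ ≤ (1 * b) * 1 := by gcongr
    _ = b := by ring

variable {ι : Type*} [Fintype ι] [DecidableEq ι] {A : Matrix ι ι ℝ}

theorem isUnit_det_of_coercive {c : ℝ} (hc : 0 < c)
    (h : ∀ v, c * l2norm v ^ 2 ≤ v ⬝ᵥ A *ᵥ v) : IsUnit A.det := by
  rw [isUnit_iff_ne_zero]
  intro h0
  obtain ⟨v, hv0, hv⟩ := exists_mulVec_eq_zero_iff.2 h0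
  have h1 := h v
  rw [hv, dotProduct_zero] at h1
  have := l2norm_pos hv0
  have : 0 < c * l2norm v ^ 2 := by positivity
  linarith

theorem norm_inv_le_of_coercive {c : ℝ} (hc : 0 < c)
    (h : ∀ v, c * l2norm v ^ 2 ≤ v ⬝ᵥ A *ᵥ v) : ‖A⁻¹‖ ≤ 1 / c := by
  refine opNorm_le_of_mulVec (by positivity) fun v => ?_
  have h1 := h (A⁻¹ *ᵥ v)
  rw [mulVec_mulVec, mul_nonsing_inv _ (isUnit_det_of_coercive hc h), one_mulVec] at h1
  have h2 := (le_abs_self _).trans (abs_dotProduct_le (A⁻¹ *ᵥ v) v)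
  rw [one_div_mul_eq_div, le_div_iff₀ hc]
  rcases (norm_nonneg (WithLp.toLp 2 (A⁻¹ *ᵥ v))).eq_or_lt with h0 | h0
  · rw [l2norm, ← h0, zero_mul]; positivity
  · refine le_of_mul_le_mul_right ?_ h0
    change l2norm (A⁻¹ *ᵥ v) * c * l2norm (A⁻¹ *ᵥ v) ≤ l2norm v * l2norm (A⁻¹ *ᵥ v)
    linarith

/-- Coercivity is stable under perturbations in operator norm. -/
theorem coercive_of_norm_sub_le {A' : Matrix ι ι ℝ} {c r : ℝ}
    (h : ∀ v, c * l2norm v ^ 2 ≤ v ⬝ᵥ A *ᵥ v) (hr : ‖A' - A‖ ≤ r) (v : ι → ℝ) :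
    (c - r) * l2norm v ^ 2 ≤ v ⬝ᵥ A' *ᵥ v := by
  have h1 := h v
  have h2 := abs_le.1 (abs_dotProduct_mulVec_le (A' - A) v v hr)
  rw [sub_mulVec, dotProduct_sub] at h2
  nlinarith [h2.1]

end Coercive

section Weights

variable {p K : ℕ} {B : Matrix (Fin p) (Fin (K + 1)) ℝ}
  {S : Matrix (Fin (K + 1)) (Fin (K + 1)) ℝ} {w : Fin (K + 1) → ℝ}

theorem IsOptimalWeight.mulVec_eq (h : IsOptimalWeight B S w) :
    B *ᵥ w = B *ᵥ Pi.single 0 1 := by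
  rw [h.1, mulVec_single_one]; rfl

/-- First order condition for the optimal weight. -/
theorem IsOptimalWeight.dotProduct_eq_zero (h : IsOptimalWeight B S w) (hS : Sᵀ = S)
    {v : Fin (K + 1) → ℝ} (hv : B *ᵥ v = 0) : v ⬝ᵥ S *ᵥ w = 0 := by
  set a := v ⬝ᵥ S *ᵥ w with ha
  set c := v ⬝ᵥ S *ᵥ v with hc
  have hsymm : w ⬝ᵥ S *ᵥ v = a := by
    rw [dotProduct_mulVec, ← mulVec_transpose, hS, dotProduct_comm]
  have h1 : ∀ t : ℝ, 0 ≤ 2 * t * a + t ^ 2 * c := by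
    intro t
    have := h.2 (w + t • v) (by rw [mulVec_add, mulVec_smul, hv, smul_zero, add_zero, h.1])
    rw [mulVec_add, mulVec_smul, dotProduct_add, add_dotProduct, add_dotProduct,
      dotProduct_smul, dotProduct_smul, smul_dotProduct, smul_dotProduct, hsymm] at this
    simp only [smul_eq_mul, ← ha, ← hc] at this
    linarith
  have hC : 0 < |c| + 1 := by positivity
  -- a step against the slope `2 a`, short enough for the quadratic term not to matter
  have h2 := h1 (-a / (|c| + 1))
  have h3 : 2 * (-a / (|c| + 1)) * a + (-a / (|c| + 1)) ^ 2 * c =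
      -(a ^ 2 * (2 * (|c| + 1) - c)) / (|c| + 1) ^ 2 := by field_simp; ring
  rw [h3, le_div_iff₀ (by positivity), zero_mul] at h2
  have h4 := le_abs_self c
  have h5 := abs_nonneg c
  have : a ^ 2 ≤ 0 := by nlinarith [sq_nonneg a]
  exact pow_eq_zero_iff (two_ne_zero) |>.1 (le_antisymm this (sq_nonneg a))

/-- First order condition for the plug-in weight. -/
theorem transpose_mulVec_plugInWeight {κ : Type*} [Fintype κ] [DecidableEq κ]
    {T : Matrix (Fin (K + 1)) κ ℝ} (h : IsUnit (Tᵀ * S * T).det) :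
    Tᵀ *ᵥ (S *ᵥ plugInWeight T S) = 0 := by
  rw [plugInWeight, mulVec_mulVec, mulVec_sub, mulVec_mulVec, sub_eq_zero]
  have : Tᵀ * S * (T * (Tᵀ * S * T)⁻¹ * Tᵀ * S) =
      (Tᵀ * S * T) * (Tᵀ * S * T)⁻¹ * (Tᵀ * S) := by
    simp only [Matrix.mul_assoc]
  rw [this, mul_nonsing_inv _ h, Matrix.one_mul]

end Weights

/-! ### Least squares algebra -/

section LeastSquares

variable {N p K : ℕ}

theorem sampleXY_response (B : Matrix (Fin p) (Fin (K + 1)) ℝ) (x : Fin N → Fin p → ℝ)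
    (e : Fin N → Fin (K + 1) → ℝ) :
    sampleXY x (response B x e) = sampleXX x * B + sampleXY x e := by
  simp only [sampleXY, sampleXX, response, vecMulVec_add, Finset.sum_add_distrib, smul_add,
    Matrix.smul_mul, Matrix.sum_mul, vecMulVec_mul]

theorem olsMatrix_response (B : Matrix (Fin p) (Fin (K + 1)) ℝ) {x : Fin N → Fin p → ℝ}
    (e : Fin N → Fin (K + 1) → ℝ) (hx : IsUnit (sampleXX x).det) :
    olsMatrix x (response B x e) = B + (sampleXX x)⁻¹ * sampleXY x e := by
  rw [olsMatrix, sampleXY_response, Matrix.mul_add, ← Matrix.mul_assoc, nonsing_inv_mul _ hx,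
    Matrix.one_mul]

theorem noiseCovHat_response (B : Matrix (Fin p) (Fin (K + 1)) ℝ) {x : Fin N → Fin p → ℝ}
    (e : Fin N → Fin (K + 1) → ℝ) (hx : IsUnit (sampleXX x).det) :
    noiseCovHat x (response B x e) =
      sampleXX e - (sampleXY x e)ᵀ * ((sampleXX x)⁻¹ * sampleXY x e) := by
  set E := (sampleXX x)⁻¹ * sampleXY x e with hE
  have hr : ∀ i, residual x (response B x e) i = e i - x i ᵥ* E := by
    intro i
    rw [residual, olsMatrix_response B e hx, response, vecMul_add]; abel
  have hxE : ∀ i, x i ᵥ* E = Eᵀ *ᵥ x i := fun i => (mulVec_transpose _ _).symm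
  have h1 : noiseCovHat x (response B x e) =
      sampleXX e - (sampleXY x e)ᵀ * E - Eᵀ * sampleXY x e + Eᵀ * sampleXX x * E := by
    have h2 : ∀ i, vecMulVec (residual x (response B x e) i) (residual x (response B x e) i) =
        vecMulVec (e i) (e i) - (vecMulVec (x i) (e i))ᵀ * E - Eᵀ * vecMulVec (x i) (e i) +
          Eᵀ * vecMulVec (x i) (x i) * E := by
      intro i
      rw [hr, sub_vecMulVec, vecMulVec_sub, vecMulVec_sub, transpose_vecMulVec, vecMulVec_mul,
        mul_vecMulVec, mul_vecMulVec, vecMulVec_mul, hxE]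
      abel
    simp only [noiseCovHat, h2, sampleXX, sampleXY, transpose_smul, transpose_sum,
      Finset.sum_add_distrib, Finset.sum_sub_distrib, smul_add, smul_sub, Matrix.smul_mul,
      Matrix.mul_smul, Matrix.sum_mul, Matrix.mul_sum]
  have h3 : Eᵀ * sampleXX x * E = Eᵀ * sampleXY x e := by
    rw [Matrix.mul_assoc, hE, ← Matrix.mul_assoc (sampleXX x), mul_nonsing_inv _ hx,
      Matrix.one_mul]
  rw [h1, h3]; abel

end LeastSquares

/-! ### The error on samples with typical moments -/

section Deterministic

theorem l2norm_single_one {ι : Type*} [Fintype ι] [DecidableEq ι] (a : ι) :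
    l2norm (Pi.single a 1 : ι → ℝ) = 1 := by
  rw [l2norm, PiLp.toLp_single, PiLp.norm_single, norm_one]

variable {N p K d : ℕ} {κ : Type*} [Fintype κ] [DecidableEq κ]

/-- The error bound for a fixed sample whose second moments deviate by at most `θ` from their
expectations, and by at most `δ` in the directions `U` of the column space of `B`. -/
theorem l2norm_weightedEst_sub_le {B : Matrix (Fin p) (Fin (K + 1)) ℝ} {U : Matrix (Fin p) κ ℝ}
    {σ : κ → ℝ} {W : Matrix (Fin (K + 1)) κ ℝ} {b : ℝ} (h : IsSVD B U σ W b) (hb : 0 < b)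
    (hd : Fintype.card κ = d) {Sxx : Matrix (Fin p) (Fin p) ℝ}
    {Se : Matrix (Fin (K + 1)) (Fin (K + 1)) ℝ} {τ τ' θ δ : ℝ} (hτ : 0 < τ) (hττ : τ ≤ τ')
    (hSxx : ∀ v, τ * l2norm v ^ 2 ≤ v ⬝ᵥ Sxx *ᵥ v)
    (hSe : ∀ v, τ * l2norm v ^ 2 ≤ v ⬝ᵥ Se *ᵥ v) (hSe' : ‖Se‖ ≤ τ') (hSeT : Seᵀ = Se)
    {x : Fin N → Fin p → ℝ} {e : Fin N → Fin (K + 1) → ℝ}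
    (h1 : ‖sampleXX x - Sxx‖ ≤ θ) (h2 : ‖sampleXY x e‖ ≤ θ) (h3 : ‖sampleXX e - Se‖ ≤ θ)
    (h4 : ‖Uᵀ * Sxx⁻¹ * sampleXY x e‖ ≤ δ) (hθ : θ ≤ τ / 4) (hθb : 2 * θ / τ ≤ b / 2)
    {w : Fin (K + 1) → ℝ} (hw : IsOptimalWeight B Se w)
    {V : Matrix (Fin (K + 1)) (Fin (K + 1)) ℝ}
    (hV : IsOrderedEigenbasis
      ((olsMatrix x (response B x e))ᵀ * olsMatrix x (response B x e)) V) :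
    l2norm (weightedEst x (response B x e) (feasibleWeight d x (response B x e) V) -
        weightedEst x (response B x e) w) ≤
      (1 + 4 * τ' / τ) * δ + (1 + 4 * τ' / τ) * (8 / (τ ^ 2 * b) + 2 / τ ^ 2 +
        2 / τ * (4 / (τ * b) + (12 * τ' / (τ * b) + 2) / τ)) * θ ^ 2 := by
  have hθ0 : 0 ≤ θ := (norm_nonneg _).trans h1
  have hc1 : ∀ v, τ / 2 * l2norm v ^ 2 ≤ v ⬝ᵥ sampleXX x *ᵥ v := fun v => by
    refine le_trans ?_ (coercive_of_norm_sub_le hSxx h1 v)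
    gcongr; linarith
  have hx : IsUnit (sampleXX x).det := isUnit_det_of_coercive (by positivity) hc1
  have hxi : ‖(sampleXX x)⁻¹‖ ≤ 2 / τ :=
    (norm_inv_le_of_coercive (by positivity) hc1).trans_eq (by field_simp)
  have hSxi : ‖Sxx⁻¹‖ ≤ 1 / τ := norm_inv_le_of_coercive hτ hSxx
  have hSxu : IsUnit Sxx.det := isUnit_det_of_coercive hτ hSxx
  set G := sampleXY x e with hG
  set E := (sampleXX x)⁻¹ * G with hE
  have hEn : ‖E‖ ≤ 2 * θ / τ := by
    calc ‖E‖ ≤ ‖(sampleXX x)⁻¹‖ * ‖G‖ := l2_opNorm_mul _ _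
      _ ≤ 2 / τ * θ := by gcongr
      _ = _ := by ring
  have hols : olsMatrix x (response B x e) = B + E := olsMatrix_response B e hx
  have hcov : ‖noiseCovHat x (response B x e) - Se‖ ≤ 2 * θ := by
    rw [noiseCovHat_response B e hx, sub_right_comm]
    refine (norm_sub_le _ _).trans ?_
    have : ‖Gᵀ * E‖ ≤ θ * (2 * θ / τ) := by
      refine (l2_opNorm_mul _ _).trans ?_
      rw [opNorm_transpose]
      gcongr
    have h5 : θ * (2 * θ / τ) ≤ θ * 1 := by
      gcongr
      rw [div_le_one hτ]; linarith
    linarith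
  have hUE : ‖Uᵀ * E‖ ≤ δ + 2 * θ ^ 2 / τ ^ 2 := by
    -- the resolvent identity `Â⁻¹ = A⁻¹ + A⁻¹ (A - Â) Â⁻¹`
    have h5 : Uᵀ * E = Uᵀ * Sxx⁻¹ * G - Uᵀ * (Sxx⁻¹ * ((sampleXX x - Sxx) * E)) := by
      have h6 : Sxx⁻¹ * ((sampleXX x - Sxx) * E) = Sxx⁻¹ * G - E := by
        rw [Matrix.sub_mul, hE, ← Matrix.mul_assoc (sampleXX x), mul_nonsing_inv _ hx,
          Matrix.one_mul, Matrix.mul_sub, ← Matrix.mul_assoc Sxx⁻¹ Sxx, nonsing_inv_mul _ hSxu,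
          Matrix.one_mul]
      rw [h6, Matrix.mul_sub, Matrix.mul_assoc]; abel
    rw [h5]
    refine (norm_sub_le _ _).trans (add_le_add h4 ?_)
    have hU := opNorm_le_one_of_orthonormal h.left
    calc _ ≤ ‖Uᵀ‖ * (‖Sxx⁻¹‖ * (‖sampleXX x - Sxx‖ * ‖E‖)) := by
          refine (l2_opNorm_mul _ _).trans ?_
          gcongr
          refine (l2_opNorm_mul _ _).trans ?_
          gcongr
          exact l2_opNorm_mul _ _
      _ ≤ 1 * (1 / τ * (θ * (2 * θ / τ))) := by
          rw [opNorm_transpose]; gcongr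
      _ = _ := by ring
  rw [hols] at hV
  have hN := h.isNoiseSpace hd hEn hθb hV
  set S' := noiseCovHat x (response B x e) with hS'
  set T := dropCols d V with hT
  have hTo : Tᵀ * T = 1 := dropCols_orthonormal hN.orthonormal d
  have hTST : IsUnit (Tᵀ * S' * T).det := by
    refine isUnit_det_of_coercive (c := τ / 2) (by positivity) fun v => ?_
    have h5 := coercive_of_norm_sub_le hSe hcov (T *ᵥ v)
    rw [l2norm_mulVec_of_orthonormal hTo] at h5
    rw [← mulVec_mulVec, ← mulVec_mulVec, dotProduct_mulVec v, vecMul_transpose]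
    refine le_trans ?_ h5
    gcongr; linarith
  have hmain := l2norm_perturbed_weight_sub_le h hb hN hEn hUE hτ hττ hSe hSe' hcov
    (by linarith) (e := Pi.single 0 1) (w := w) (w' := plugInWeight T S')
    (a := (Tᵀ * S' * T)⁻¹ *ᵥ ((Tᵀ * S') *ᵥ Pi.single 0 1))
    (l2norm_single_one 0) hw.mulVec_eq
    (fun v hv => hw.dotProduct_eq_zero hSeT hv)
    (by rw [plugInWeight, ← hT, mulVec_mulVec, mulVec_mulVec]; simp only [Matrix.mul_assoc])
    (transpose_mulVec_plugInWeight hTST)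
  rw [weightedEst, weightedEst, hols, feasibleWeight, ← mulVec_sub]
  refine hmain.trans_eq ?_
  field_simp
  ring

end Deterministic

/-! ### Sub-Gaussian vectors -/

section SubGaussian

variable {Ω : Type*} [MeasurableSpace Ω] {μ : Measure Ω} {ι ι' : Type*} [Fintype ι] [Fintype ι']

/-- A bound `C` on the sub-Gaussian norm gives the exponential moment at every scale `κ > C`; the
infimum in `psi2Norm` need not be known to be attained. -/
theorem lintegral_exp_le_of_psi2NormVec_le [IsProbabilityMeasure μ] {V : Ω → ι → ℝ} {C κ : ℝ}
    (hκ : 0 < κ) (hC : C < κ) (h : psi2NormVec μ V ≤ ENNReal.ofReal C) {u : ι → ℝ}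
    (hu : l2norm u ≤ 1) :
    ∫⁻ ω, ENNReal.ofReal (Real.exp ((u ⬝ᵥ V ω) ^ 2 / κ ^ 2)) ∂μ ≤ 2 := by
  rcases (norm_nonneg (WithLp.toLp 2 u)).eq_or_lt with h0 | h0
  · have : u = 0 := by simpa using norm_eq_zero.1 h0.symm
    simp [this]
  set v := (l2norm u)⁻¹ • u with hv
  have hv1 : v ⬝ᵥ v = 1 := by rw [← l2norm_sq, hv, l2norm_inv_smul h0.ne', one_pow]
  have huv : u = l2norm u • v := by rw [hv, smul_smul, mul_inv_cancel₀ h0.ne', one_smul]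
  have h1 : psi2Norm μ (fun ω => v ⬝ᵥ V ω) < ENNReal.ofReal κ :=
    ((le_iSup₂ (f := fun (u : ι → ℝ) (_ : u ⬝ᵥ u = 1) => psi2Norm μ (fun ω => u ⬝ᵥ V ω))
      v hv1).trans h).trans_lt ((ENNReal.ofReal_lt_ofReal_iff hκ).2 hC)
  simp only [psi2Norm, iInf_lt_iff] at h1
  obtain ⟨t, ht, hint, htκ⟩ := h1
  rw [ENNReal.ofReal_lt_ofReal_iff hκ] at htκ
  refine le_trans (lintegral_mono fun ω => ?_) hint
  refine ENNReal.ofReal_le_ofReal (Real.exp_le_exp.2 ?_)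
  have h2 : u ⬝ᵥ V ω = l2norm u * (v ⬝ᵥ V ω) := by
    conv_lhs => rw [huv]
    rw [smul_dotProduct, smul_eq_mul]
  rw [h2, mul_pow]
  have h3 : l2norm u ^ 2 ≤ 1 := pow_le_one₀ (norm_nonneg _) hu
  calc l2norm u ^ 2 * (v ⬝ᵥ V ω) ^ 2 / κ ^ 2 ≤ 1 * (v ⬝ᵥ V ω) ^ 2 / t ^ 2 := by gcongr
    _ = _ := by rw [one_mul]

theorem integrable_mul_of_subGaussian {U V : Ω → ℝ} (hU : Measurable U) (hV : Measurable V)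
    {κ : ℝ} (hκ : 0 < κ)
    (h1 : ∫⁻ ω, ENNReal.ofReal (Real.exp (U ω ^ 2 / κ ^ 2)) ∂μ ≤ 2)
    (h2 : ∫⁻ ω, ENNReal.ofReal (Real.exp (V ω ^ 2 / κ ^ 2)) ∂μ ≤ 2) :
    Integrable (fun ω => U ω * V ω) μ := by
  have := (integrable_of_exp_abs ((hU.mul hV).div_const (κ ^ 2))
    (lintegral_exp_abs_mul_le hU hV h1 h2)).mul_const (κ ^ 2)
  refine this.congr (ae_of_all _ fun ω => ?_)
  have : κ ^ 2 ≠ 0 := by positivity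
  simp only [Pi.mul_apply]
  field_simp

/-- Second moments of linear functionals from those of the coordinates; the sub-Gaussian hypotheses
give the integrability. -/
theorem integral_dotProduct_mul_dotProduct [DecidableEq ι] [DecidableEq ι'] {P : Ω → ι → ℝ}
    {Q : Ω → ι' → ℝ}
    {M : Matrix ι ι' ℝ} {κ : ℝ} (hκ : 0 < κ) (hPm : Measurable P) (hQm : Measurable Q)
    (hP : ∀ u, l2norm u ≤ 1 → ∫⁻ ω, ENNReal.ofReal (Real.exp ((u ⬝ᵥ P ω) ^ 2 / κ ^ 2)) ∂μ ≤ 2)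
    (hQ : ∀ v, l2norm v ≤ 1 → ∫⁻ ω, ENNReal.ofReal (Real.exp ((v ⬝ᵥ Q ω) ^ 2 / κ ^ 2)) ∂μ ≤ 2)
    (hM : ∀ a b, ∫ ω, P ω a * Q ω b ∂μ = M a b) (u : ι → ℝ) (v : ι' → ℝ) :
    ∫ ω, (u ⬝ᵥ P ω) * (v ⬝ᵥ Q ω) ∂μ = u ⬝ᵥ M *ᵥ v := by
  have hint : ∀ a b, Integrable (fun ω => P ω a * Q ω b) μ := fun a b => by
    refine integrable_mul_of_subGaussian ((measurable_pi_apply a).comp hPm)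
      ((measurable_pi_apply b).comp hQm) hκ ?_ ?_
    · simpa using hP _ (l2norm_single_one a).le
    · simpa using hQ _ (l2norm_single_one b).le
  have h1 : ∀ ω, (u ⬝ᵥ P ω) * (v ⬝ᵥ Q ω) = ∑ a, ∑ b, u a * v b * (P ω a * Q ω b) := fun ω => by
    simp only [dotProduct, Finset.sum_mul_sum]
    exact Finset.sum_congr rfl fun a _ => Finset.sum_congr rfl fun b _ => by ring
  simp only [h1]
  rw [integral_finsetSum _ fun a _ => integrable_finsetSum _ fun b _ => (hint a b).const_mul _]
  simp only [dotProduct, mulVec, Finset.mul_sum]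
  refine Finset.sum_congr rfl fun a _ => ?_
  rw [integral_finsetSum _ fun b _ => (hint a b).const_mul _]
  refine Finset.sum_congr rfl fun b _ => ?_
  rw [integral_const_mul, hM]; ring

end SubGaussian

/-! ### Concentration of the sample moments of the model -/

section Model

variable {Ω : Type*} [MeasurableSpace Ω] {μ : Measure Ω} {N p K : ℕ}
  {X : Fin N → Ω → Fin p → ℝ} {e : Fin N → Ω → Fin (K + 1) → ℝ}
  {Sxx : Matrix (Fin p) (Fin p) ℝ} {Se : Matrix (Fin (K + 1)) (Fin (K + 1)) ℝ} {C κ : ℝ}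

theorem l2norm_sumElim {ι ι' : Type*} [Fintype ι] [Fintype ι'] (u : ι → ℝ) (v : ι' → ℝ) :
    l2norm (Sum.elim u v) ^ 2 = l2norm u ^ 2 + l2norm v ^ 2 := by
  rw [l2norm_sq, l2norm_sq, l2norm_sq, sumElim_dotProduct_sumElim]

theorem SubGaussianCondition.covariate [IsProbabilityMeasure μ]
    (h : SubGaussianCondition μ X e C) (hκ : 0 < κ) (hC : C < κ)
    (i : Fin N) (u : Fin p → ℝ) (hu : l2norm u ≤ 1) :
    ∫⁻ ω, ENNReal.ofReal (Real.exp ((u ⬝ᵥ X i ω) ^ 2 / κ ^ 2)) ∂μ ≤ 2 := by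
  have := lintegral_exp_le_of_psi2NormVec_le hκ hC (h i)
    (u := Sum.elim u (0 : Fin (K + 1) → ℝ)) (by
      refine le_of_sq_le_sq ?_ zero_le_one
      rw [l2norm_sumElim, l2norm_sq 0, zero_dotProduct, add_zero]
      gcongr)
  simpa [sumElim_dotProduct_sumElim] using this

theorem SubGaussianCondition.noise [IsProbabilityMeasure μ]
    (h : SubGaussianCondition μ X e C) (hκ : 0 < κ) (hC : C < κ)
    (i : Fin N) (u : Fin (K + 1) → ℝ) (hu : l2norm u ≤ 1) :
    ∫⁻ ω, ENNReal.ofReal (Real.exp ((u ⬝ᵥ e i ω) ^ 2 / κ ^ 2)) ∂μ ≤ 2 := by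
  have := lintegral_exp_le_of_psi2NormVec_le hκ hC (h i)
    (u := Sum.elim (0 : Fin p → ℝ) u) (by
      refine le_of_sq_le_sq ?_ zero_le_one
      rw [l2norm_sumElim, l2norm_sq 0, zero_dotProduct, zero_add]
      gcongr)
  simpa [sumElim_dotProduct_sumElim] using this

namespace IsRegressionModel

theorem indep_pair (h : IsRegressionModel μ X e Sxx Se) {α : Fin N → Type*}
    [∀ i, MeasurableSpace (α i)] (g : ∀ i, (Fin p → ℝ) × (Fin (K + 1) → ℝ) → α i)
    (hg : ∀ i, Measurable (g i)) : iIndepFun (fun i ω => g i (X i ω, e i ω)) μ :=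
  h.indep.comp (fun i z => g i (z ∘ Sum.inl, z ∘ Sum.inr)) fun i =>
    (hg i).comp (Measurable.prodMk (measurable_pi_lambda _ fun _ => measurable_pi_apply _)
      (measurable_pi_lambda _ fun _ => measurable_pi_apply _))

theorem secondMoment_e (h : IsRegressionModel μ X e Sxx Se) (i : Fin N) (k l : Fin (K + 1)) :
    ∫ ω, e i ω k * e i ω l ∂μ = Se k l := by
  have := h.cov_e i k l
  rw [covariance, h.mean_e, h.mean_e] at this
  simpa using this

theorem Sxx_transpose (h : IsRegressionModel μ X e Sxx Se) (hN : 0 < N) : Sxxᵀ = Sxx := by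
  ext a b
  rw [transpose_apply, ← h.secondMoment_X ⟨0, hN⟩, ← h.secondMoment_X ⟨0, hN⟩]
  simp only [mul_comm]

theorem Se_transpose (h : IsRegressionModel μ X e Sxx Se) (hN : 0 < N) : Seᵀ = Se := by
  ext a b
  rw [transpose_apply, ← h.secondMoment_e ⟨0, hN⟩, ← h.secondMoment_e ⟨0, hN⟩]
  simp only [mul_comm]

theorem sampleXX_X_concentration [IsProbabilityMeasure μ]
    (h : IsRegressionModel μ X e Sxx Se) (hs : SubGaussianCondition μ X e C)
    (hκ : 0 < κ) (hC : C < κ) (hN : 0 < N)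
    {n : ℕ} (hdim : 2 * p ≤ 2 * n) (hn : 17 * Real.sqrt (n / N) ≤ 16) :
    μ {ω | 68 * κ ^ 2 * Real.sqrt (n / N) < ‖sampleXX (fun i => X i ω) - Sxx‖} ≤
      ENNReal.ofReal (2 * Real.exp (-(n : ℝ))) :=
  crossMoment_concentration hκ hN (by simpa [two_mul] using hdim) hn h.measurable_X h.measurable_X
    (h.indep_pair (fun _ z => (z.1, z.1)) fun _ => by fun_prop)
    (hs.covariate hκ hC) (hs.covariate hκ hC) fun i u v _ _ =>
      integral_dotProduct_mul_dotProduct hκ (h.measurable_X i) (h.measurable_X i)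
        (hs.covariate hκ hC i) (hs.covariate hκ hC i) (h.secondMoment_X i) u v

theorem sampleXX_e_concentration [IsProbabilityMeasure μ]
    (h : IsRegressionModel μ X e Sxx Se) (hs : SubGaussianCondition μ X e C)
    (hκ : 0 < κ) (hC : C < κ) (hN : 0 < N)
    {n : ℕ} (hdim : 2 * (K + 1) ≤ 2 * n) (hn : 17 * Real.sqrt (n / N) ≤ 16) :
    μ {ω | 68 * κ ^ 2 * Real.sqrt (n / N) < ‖sampleXX (fun i => e i ω) - Se‖} ≤
      ENNReal.ofReal (2 * Real.exp (-(n : ℝ))) :=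
  crossMoment_concentration hκ hN (by simpa [two_mul] using hdim) hn h.measurable_e h.measurable_e
    (h.indep_pair (fun _ z => (z.2, z.2)) fun _ => by fun_prop)
    (hs.noise hκ hC) (hs.noise hκ hC) fun i u v _ _ =>
      integral_dotProduct_mul_dotProduct hκ (h.measurable_e i) (h.measurable_e i)
        (hs.noise hκ hC i) (hs.noise hκ hC i) (h.secondMoment_e i) u v

/-- Concentration of the sample cross moments of the noise and a linear image of the
covariates. -/
theorem mul_sampleXY_concentration [IsProbabilityMeasure μ]
    (h : IsRegressionModel μ X e Sxx Se) (hs : SubGaussianCondition μ X e C)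
    (hκ : 0 < κ) (hC : C < κ) (hN : 0 < N)
    {ι : Type*} [Fintype ι] [DecidableEq ι] {L : Matrix ι (Fin p) ℝ} (hL : ‖L‖ ≤ 1)
    {n : ℕ} (hdim : Fintype.card ι + (K + 1) ≤ 2 * n) (hn : 17 * Real.sqrt (n / N) ≤ 16) :
    μ {ω | 68 * κ ^ 2 * Real.sqrt (n / N) <
        ‖L * sampleXY (fun i => X i ω) (fun i => e i ω)‖} ≤
      ENNReal.ofReal (2 * Real.exp (-(n : ℝ))) := by
  have hLm : Measurable fun z : Fin p → ℝ => L *ᵥ z := by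
    refine measurable_pi_lambda _ fun a => ?_
    simp only [mulVec, dotProduct]
    fun_prop
  have hu : ∀ u : ι → ℝ, l2norm u ≤ 1 → l2norm (u ᵥ* L) ≤ 1 := fun u hu => by
    rw [← mulVec_transpose]
    refine (l2norm_mulVec_le _ _).trans ?_
    rw [opNorm_transpose]
    exact mul_le_one₀ hL (norm_nonneg _) hu
  have := crossMoment_concentration (μ := μ) (P := fun i ω => L *ᵥ X i ω) (Q := e) (M := 0)
    hκ hN (by simpa using hdim) hn
    (fun i => hLm.comp (h.measurable_X i)) h.measurable_e
    (h.indep_pair (fun _ z => (L *ᵥ z.1, z.2)) fun _ =>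
      (hLm.comp measurable_fst).prodMk measurable_snd)
    (fun i u hu' => by simpa only [dotProduct_mulVec] using hs.covariate hκ hC i _ (hu u hu'))
    (hs.noise hκ hC) (fun i u v _ _ => by
      have := integral_dotProduct_mul_dotProduct (M := 0) hκ (h.measurable_X i) (h.measurable_e i)
        (hs.covariate hκ hC i) (hs.noise hκ hC i) (h.uncorrelated i) (u ᵥ* L) v
      simpa [dotProduct_mulVec] using this)
  refine le_trans (measure_mono fun ω hω => ?_) this
  rw [Set.mem_ofPred_eq] at hω ⊢
  rw [sub_zero]
  refine hω.trans_eq ?_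
  congr 1
  rw [sampleXY, Matrix.mul_smul, Matrix.mul_sum]
  simp only [mul_vecMulVec]

end IsRegressionModel

end Model

/-! ### The oracle comparison -/

theorem DivergenceCondition.eventually_le {K p : ℕ → ℕ} (h : DivergenceCondition K p) :
    ∀ᶠ N in atTop, K N + 1 ≤ p N := by
  filter_upwards [h.K_div_p.eventually_lt_const (show (0 : ℝ) < 1 / 2 by norm_num),
    h.p_tendsto.eventually_ge_atTop 2] with N h1 h2
  have h3 : (0 : ℝ) < p N := by exact_mod_cast (by omega : 0 < p N)
  rw [div_lt_iff₀ h3] at h1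
  have h4 : (2 * K N : ℝ) < p N := by linarith
  have h5 : 2 * K N < p N := by exact_mod_cast h4
  omega

theorem DivergenceCondition.eventually_sqrt_le {K p : ℕ → ℕ} (h : DivergenceCondition K p)
    {r : ℝ} (hr : 0 < r) : ∀ᶠ N in atTop, Real.sqrt ((p N : ℝ) / N) ≤ r := by
  have := h.p_div_N.sqrt
  rw [Real.sqrt_zero] at this
  exact this.eventually_le_const hr

/-- The oracle comparison for a fixed sample size, with explicit constants. -/
theorem IsRegressionModel.measure_error_le {Ω : Type*} [MeasurableSpace Ω] {μ : Measure Ω}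
    [IsProbabilityMeasure μ] {N p K d : ℕ} {X : Fin N → Ω → Fin p → ℝ}
    {e : Fin N → Ω → Fin (K + 1) → ℝ} {Sxx : Matrix (Fin p) (Fin p) ℝ}
    {Se : Matrix (Fin (K + 1)) (Fin (K + 1)) ℝ} {B : Matrix (Fin p) (Fin (K + 1)) ℝ}
    {C κ τ τ' b : ℝ} (hτ : 0 < τ) (hττ : τ ≤ τ') (hκ : 0 < κ) (hC : C < κ)
    (hb : b = Real.sqrt τ)
    (h : IsRegressionModel μ X e Sxx Se) (hs : SubGaussianCondition μ X e C)
    (hSxx : EigenvaluesIn Sxx τ τ') (hSe : EigenvaluesIn Se τ τ')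
    (hB : CoefficientCondition B d τ τ') (hN : 0 < N) (hKp : K + 1 ≤ p)
    (hsmall : Real.sqrt ((p : ℝ) / N) ≤ 8 / 17)
    (hθ : 68 * κ ^ 2 * Real.sqrt ((p : ℝ) / N) ≤ τ / 4)
    (hθb : 2 * (68 * κ ^ 2 * Real.sqrt ((p : ℝ) / N)) / τ ≤ b / 2)
    {w : Fin (K + 1) → ℝ} (hw : IsOptimalWeight B Se w) {x : Ω → Fin N → Fin p → ℝ}
    {y : Ω → Fin N → Fin (K + 1) → ℝ} (hx : ∀ ω, x ω = fun i => X i ω)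
    (hy : ∀ ω, y ω = response B (x ω) (fun i => e i ω))
    {V : Ω → Matrix (Fin (K + 1)) (Fin (K + 1)) ℝ}
    (hV : ∀ ω, IsOrderedEigenbasis ((olsMatrix (x ω) (y ω))ᵀ * olsMatrix (x ω) (y ω)) (V ω)) :
    μ {ω | (1 + 4 * τ' / τ) * (68 * κ ^ 2 * Real.sqrt (((K : ℝ) + d) / N) / τ) +
          (1 + 4 * τ' / τ) * (8 / (τ ^ 2 * b) + 2 / τ ^ 2 +
            2 / τ * (4 / (τ * b) + (12 * τ' / (τ * b) + 2) / τ)) *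
          (68 * κ ^ 2 * Real.sqrt ((p : ℝ) / N)) ^ 2 <
        l2norm (weightedEst (x ω) (y ω) (feasibleWeight d (x ω) (y ω) (V ω)) -
          weightedEst (x ω) (y ω) w)} ≤
      ENNReal.ofReal (8 * Real.exp (-(K : ℝ))) := by
  obtain ⟨U, σ, W, hsvd⟩ := hB.exists_isSVD hτ
  rw [← hb] at hsvd
  have hb0 : 0 < b := hb ▸ Real.sqrt_pos.2 hτ
  have hd1 := hB.pos
  have hd2 := hB.lt
  have hcard : Fintype.card {k : Fin (K + 1) // (k : ℕ) < d} = d :=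
    Fintype.card_fin_lt_of_le hd2.le
  have hSxxT : Sxx.IsHermitian := by
    rw [IsHermitian, conjTranspose_eq_transpose_of_trivial, h.Sxx_transpose hN]
  have hSeT : Se.IsHermitian := by
    rw [IsHermitian, conjTranspose_eq_transpose_of_trivial, h.Se_transpose hN]
  have hN' : (0 : ℝ) < N := by exact_mod_cast hN
  have hn1 : 17 * Real.sqrt ((p : ℝ) / N) ≤ 16 := by linarith
  have hn2 : 17 * Real.sqrt (((K + d : ℕ) : ℝ) / N) ≤ 16 := by
    have : Real.sqrt (((K + d : ℕ) : ℝ) / N) ≤ 2 * Real.sqrt ((p : ℝ) / N) := by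
      rw [show (2 : ℝ) = Real.sqrt (2 ^ 2) by rw [Real.sqrt_sq (by norm_num)],
        ← Real.sqrt_mul (by norm_num), ← mul_div_assoc]
      refine Real.sqrt_le_sqrt ?_
      gcongr
      have : K + d ≤ 4 * p := by omega
      norm_num
      exact_mod_cast this
    linarith
  -- the part of the noise in the column space of `B`, normalized to a linear map of norm `≤ 1`
  have hL : ‖τ • (Uᵀ * Sxx⁻¹)‖ ≤ 1 := by
    rw [norm_smul, Real.norm_of_nonneg hτ.le]
    have h1 := norm_inv_le_of_coercive hτ (hSxx.mul_sq_le hSxxT)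
    have h2 := opNorm_le_one_of_orthonormal hsvd.left
    calc τ * ‖Uᵀ * Sxx⁻¹‖ ≤ τ * (1 * (1 / τ)) := by
          gcongr
          refine (l2_opNorm_mul _ _).trans ?_
          rw [opNorm_transpose]; gcongr
      _ = 1 := by field_simp
  have hA1 := h.sampleXX_X_concentration hs hκ hC hN le_rfl hn1
  have hA2 := h.mul_sampleXY_concentration hs hκ hC hN (L := (1 : Matrix (Fin p) (Fin p) ℝ))
    (opNorm_le_one_of_orthonormal (by simp)) (n := p) (by simp; omega) hn1
  have hA3 := h.sampleXX_e_concentration hs hκ hC hN (n := p) (by omega) hn1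
  have hA4 := h.mul_sampleXY_concentration hs hκ hC hN hL (n := K + d)
    (by rw [hcard]; omega) hn2
  have hexp : ∀ n : ℕ, K ≤ n → ENNReal.ofReal (2 * Real.exp (-(n : ℝ))) ≤
      ENNReal.ofReal (2 * Real.exp (-(K : ℝ))) := fun n hn => by
    refine ENNReal.ofReal_le_ofReal ?_
    gcongr
  set A1 := {ω | 68 * κ ^ 2 * Real.sqrt ((p : ℝ) / N) < ‖sampleXX (fun i => X i ω) - Sxx‖}
  set A2 := {ω | 68 * κ ^ 2 * Real.sqrt ((p : ℝ) / N) <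
    ‖(1 : Matrix (Fin p) (Fin p) ℝ) * sampleXY (fun i => X i ω) (fun i => e i ω)‖}
  set A3 := {ω | 68 * κ ^ 2 * Real.sqrt ((p : ℝ) / N) < ‖sampleXX (fun i => e i ω) - Se‖}
  set A4 := {ω | 68 * κ ^ 2 * Real.sqrt (((K + d : ℕ) : ℝ) / N) <
    ‖τ • (Uᵀ * Sxx⁻¹) * sampleXY (fun i => X i ω) (fun i => e i ω)‖}
  have hsub : ∀ ω, ω ∉ A1 → ω ∉ A2 → ω ∉ A3 → ω ∉ A4 →
      l2norm (weightedEst (x ω) (y ω) (feasibleWeight d (x ω) (y ω) (V ω)) -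
          weightedEst (x ω) (y ω) w) ≤
        (1 + 4 * τ' / τ) * (68 * κ ^ 2 * Real.sqrt (((K : ℝ) + d) / N) / τ) +
          (1 + 4 * τ' / τ) * (8 / (τ ^ 2 * b) + 2 / τ ^ 2 +
            2 / τ * (4 / (τ * b) + (12 * τ' / (τ * b) + 2) / τ)) *
          (68 * κ ^ 2 * Real.sqrt ((p : ℝ) / N)) ^ 2 := by
    intro ω h1 h2 h3 h4
    simp only [A1, A2, A3, A4, Set.mem_ofPred_eq, not_lt] at h1 h2 h3 h4
    rw [Matrix.one_mul] at h2
    rw [Matrix.smul_mul, norm_smul, Real.norm_of_nonneg hτ.le, Nat.cast_add] at h4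
    have hVω := hV ω
    rw [hy, hx] at hVω ⊢
    refine l2norm_weightedEst_sub_le hsvd hb0 hcard hτ hττ (hSxx.mul_sq_le hSxxT)
      (hSe.mul_sq_le hSeT) (hSe.norm_le hSeT hτ.le (hτ.le.trans hττ)) (h.Se_transpose hN)
      h1 h2 h3 ?_ hθ hθb hw hVω
    rw [le_div_iff₀ hτ]
    linarith
  calc _ ≤ μ (A1 ∪ A2 ∪ A3 ∪ A4) := by
        refine measure_mono fun ω hω => ?_
        by_contra hcon
        simp only [Set.mem_union, not_or] at hcon
        exact absurd (hsub ω hcon.1.1.1 hcon.1.1.2 hcon.1.2 hcon.2) (not_le.2 hω)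
    _ ≤ μ A1 + μ A2 + μ A3 + μ A4 := by
        refine (measure_union_le _ _).trans ?_
        gcongr
        refine (measure_union_le _ _).trans ?_
        gcongr
        exact measure_union_le _ _
    _ ≤ ENNReal.ofReal (2 * Real.exp (-(K : ℝ))) + ENNReal.ofReal (2 * Real.exp (-(K : ℝ))) +
        ENNReal.ofReal (2 * Real.exp (-(K : ℝ))) + ENNReal.ofReal (2 * Real.exp (-(K : ℝ))) := by
        gcongr
        · exact hA1.trans (hexp p (by omega))
        · exact hA2.trans (hexp p (by omega))
        · exact hA3.trans (hexp p (by omega))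
        · exact hA4.trans (hexp _ (by omega))
    _ = _ := by
        rw [← ENNReal.ofReal_add (by positivity) (by positivity),
          ← ENNReal.ofReal_add (by positivity) (by positivity),
          ← ENNReal.ofReal_add (by positivity) (by positivity)]
        congr 1; ring

end AuxLearning

theorem theorem1 (Csub τmin τmax : ℝ) (hτ : 0 < τmin) (hττ : τmin ≤ τmax) :
    -- the constants depend on `Csub`, `τmin` and `τmax` only
    ∃ C₁ C₂ : ℝ, 0 < C₁ ∧ 0 < C₂ ∧
      ∀ K p : ℕ → ℕ, AuxLearning.DivergenceCondition K p →
      ∃ N₀ : ℕ, ∀ N : ℕ, N₀ < N →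
      -- a probability space, a sample of size `N` and the parameters of the model
      ∀ (Ω : Type*) [MeasurableSpace Ω] (μ : Measure Ω) [IsProbabilityMeasure μ]
        (X : Fin N → Ω → Fin (p N) → ℝ) (e : Fin N → Ω → Fin (K N + 1) → ℝ)
        (B : Matrix (Fin (p N)) (Fin (K N + 1)) ℝ) (d : ℕ)
        (Sxx : Matrix (Fin (p N)) (Fin (p N)) ℝ)
        (Se : Matrix (Fin (K N + 1)) (Fin (K N + 1)) ℝ),
      AuxLearning.IsRegressionModel μ X e Sxx Se →
      AuxLearning.SubGaussianCondition μ X e Csub →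
      AuxLearning.EigenvaluesIn Sxx τmin τmax →
      AuxLearning.EigenvaluesIn Se τmin τmax →
      AuxLearning.CoefficientCondition B d τmin τmax →
      -- the oracle weight
      ∀ wstar : Fin (K N + 1) → ℝ, AuxLearning.IsOptimalWeight B Se wstar →
      -- the observed data
      ∀ (x : Ω → Fin N → Fin (p N) → ℝ) (y : Ω → Fin N → Fin (K N + 1) → ℝ),
      (∀ ω, x ω = fun i => X i ω) →
      (∀ ω, y ω = AuxLearning.response B (x ω) (fun i => e i ω)) →
      -- any choice of ordered orthonormal eigenvectors of the estimated Gram matrix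
      ∀ V : Ω → Matrix (Fin (K N + 1)) (Fin (K N + 1)) ℝ,
      (∀ ω, AuxLearning.IsOrderedEigenbasis
        ((AuxLearning.olsMatrix (x ω) (y ω))ᵀ * AuxLearning.olsMatrix (x ω) (y ω)) (V ω)) →
      -- the (outer) probability that the bound fails is at most `C₂ exp (-K)`
      μ {ω | ¬ ‖WithLp.toLp 2
            (AuxLearning.weightedEst (x ω) (y ω)
                (AuxLearning.feasibleWeight d (x ω) (y ω) (V ω))
              - AuxLearning.weightedEst (x ω) (y ω) wstar)‖
          ≤ C₁ * (Real.sqrt (((K N : ℝ) + (d : ℝ)) / (N : ℝ)) + (p N : ℝ) / (N : ℝ))}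
        ≤ ENNReal.ofReal (C₂ * Real.exp (-(K N : ℝ))) := by
  have hτ' : 0 < τmax := hτ.trans_le hττ
  -- a scale strictly above the sub-Gaussian norm
  set κ : ℝ := |Csub| + 1 with hκdef
  have hκ : 0 < κ := by positivity
  have hC : Csub < κ := by linarith [le_abs_self Csub]
  set b : ℝ := Real.sqrt τmin with hb
  have hb0 : 0 < b := Real.sqrt_pos.2 hτ
  set c : ℝ := 68 * κ ^ 2 with hc
  have hc0 : 0 < c := by positivity
  set M : ℝ := 1 + 4 * τmax / τmin with hM
  have hM0 : 0 < M := by positivity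
  set L : ℝ := 8 / (τmin ^ 2 * b) + 2 / τmin ^ 2 +
    2 / τmin * (4 / (τmin * b) + (12 * τmax / (τmin * b) + 2) / τmin) with hL
  have hL0 : 0 < L := by positivity
  refine ⟨M * (c / τmin) + M * L * c ^ 2, 8, by positivity, by norm_num, fun K p hKp => ?_⟩
  have hev := (hKp.eventually_le.and
    (hKp.eventually_sqrt_le (show (0 : ℝ) < 8 / 17 by norm_num))).and
    ((hKp.eventually_sqrt_le (show (0 : ℝ) < τmin / 4 / c by positivity)).and
      (hKp.eventually_sqrt_le (show (0 : ℝ) < b / 2 * τmin / (2 * c) by positivity)))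
  obtain ⟨N₀, hN₀⟩ := eventually_atTop.1 hev
  refine ⟨N₀, fun N hN Ω _ μ _ X e B d Sxx Se h hs hSxx hSe hB w hw x y hx hy V hV => ?_⟩
  obtain ⟨⟨h1, h2⟩, h3, h4⟩ := hN₀ N hN.le
  rw [le_div_iff₀ hc0] at h3
  rw [le_div_iff₀ (by positivity)] at h4
  refine le_trans (measure_mono fun ω hω => ?_)
    (h.measure_error_le hτ hττ hκ hC hb hs hSxx hSe hB (by omega) h1 h2 (by linarith)
      (by rw [div_le_iff₀ hτ]; linarith) hw hx hy hV)
  rw [Set.mem_ofPred_eq, not_le] at hω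
  rw [Set.mem_ofPred_eq]
  refine lt_of_le_of_lt ?_ hω
  rw [mul_pow, Real.sq_sqrt (by positivity)]
  set s := Real.sqrt (((K N : ℝ) + (d : ℝ)) / (N : ℝ)) with hs'
  have hs0 : 0 ≤ s := Real.sqrt_nonneg _
  have hr0 : 0 ≤ (p N : ℝ) / (N : ℝ) := by positivity
  have e1 : 0 ≤ M * (c / τmin) * ((p N : ℝ) / (N : ℝ)) := by positivity
  have e2 : 0 ≤ M * L * c ^ 2 * s := by positivity
  calc _ = M * (c / τmin) * s + M * L * c ^ 2 * ((p N : ℝ) / (N : ℝ)) := by ring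
    _ ≤ _ := by linarith
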